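/- Let $\Bbbk$ be a field of characteristic $0$, let $A$ be a commutative $\Bbbk$-algebra, and let $(A,\mathfrak g,\omega)$ be a Lie–Rinehart algebra over $A$ (a $\Bbbk$-Lie algebra $\mathfrak g$ with an $A$-module structure and an $A$-linear morphism of Lie algebras $\omega\colon\mathfrak g\to\mathrm{Der}_{\Bbbk}(A)$ such that $[X,aY]=a[X,Y]+\omega(X)(a)Y$) which is projective as an $A$-module. Let $\mathcal U_A(\mathfrak g)$ be its universal enveloping algebra, that is, the $\Bbbk$-algebra which is universal among those with a morphism of algebras $\iota_A$ from $A$ and a morphism of Lie algebras $\iota_{\mathfrak g}$ from $\mathfrak g$ satisfying $\iota_{\mathfrak g}(aX)=\iota_A(a)\iota_{\mathfrak g}(X)$ and $\iota_{\mathfrak g}(X)\iota_A(a)-\iota_A(a)\iota_{\mathfrak g}(X)=\iota_A(\omega(X)(a))$. Regard $\mathcal U_A(\mathfrak g)$ as an $A$-module by left multiplication, and as an $A$-coring (for the $A$-bimodule structure with both actions given by this left action, so that an $A$-coring here is the same as an $A$-coalgebra) with the left $A$-linear comultiplication and counit determined by $$\Delta(1)=1\otimes_A 1,\quad \Delta(Xu)=Xu_{(1)}\otimes_A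 u_{(2)}+u_{(1)}\otimes_A Xu_{(2)},\qquad \varepsilon(1)=1,\quad \varepsilon(Xu)=\omega(X)(\varepsilon(u))$$ for $X\in\mathfrak g$ and $u\in\mathcal U_A(\mathfrak g)$. Regard the symmetric algebra $\mathcal S_A(\mathfrak g)$ as an $A$-coring with its usual $A$-bialgebra structure, in which the elements of $\mathfrak g$ are primitive. Let $\{\chi_i,\varphi_i\mid i\in I\}$ be a projective basis of $\mathfrak g$, that is, $\chi_i\in\mathfrak g$ and $\varphi_i\in\mathrm{Hom}_A(\mathfrak g,A)$ are such that for every $X\in\mathfrak g$ one has $\varphi_i(X)=0$ for all but finitely many $i$, and $X=\sum_i\varphi_i(X)\chi_i$. Let $\mathrm S\colon\mathcal S_A(\mathfrak g)\to\mathcal U_A(\mathfrak g)$ be the associated symmetrisation map, that is, the $A$-linear map with $$\mathrm S(X_1\cdots X_n)=\frac1{n!}\sum_{j_1,\dots,j_n\in I}\ \sum_{\sigma\in\mathfrak S_n}\varphi_{j_1}(X_1)\cdots\varphi_{j_n}(X_n)\,\chi_{j_{\sigma(1)}}\cdots\chi_{j_{\sigma(n)}}$$ for all $n\ge 0$ and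 $X_1,\dots,X_n\in\mathfrak g$ (for $n=0$ this reads $\mathrm S(1)=1$). Then $\mathrm S$ is an isomorphism of $A$-corings: it is $A$-linear and bijective, $\Delta_{\mathcal U}\circ \mathrm S=(\mathrm S\otimes_A \mathrm S)\circ\Delta_{\mathcal S}$ and $\varepsilon_{\mathcal U}\circ \mathrm S=\varepsilon_{\mathcal S}$. -/

import Mathlib

open scoped TensorProduct

/-! ### The universal enveloping algebra of a Lie-Rinehart algebra

A Lie-Rinehart algebra `(A, g, ω)` over `k` is Mathlib's `LieRinehartAlgebra k A g`; the value
`ω(X)(a)` of the anchor is written `⁅X, a⁆`. -/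

namespace LRUniversalEnveloping

/-- The relations of `U_A(g)`, imposed on the free `k`-algebra on the disjoint union of `A` and `g`:
`A → U` is a morphism of `k`-algebras, `g → U` is a morphism of `k`-Lie algebras,
`ι(a • X) = ι(a) ι(X)` and `ι(X) ι(a) - ι(a) ι(X) = ι(ω(X)(a))`. -/
inductive Rel (k A g : Type*) [CommRing k] [CommRing A] [Algebra k A] [LieRing g] [LieAlgebra k g]
    [Module A g] [LieRingModule g A] : FreeAlgebra k (A ⊕ g) → FreeAlgebra k (A ⊕ g) → Prop
  | scalar (r : k) : Rel k A g (FreeAlgebra.ι k (.inl (algebraMap k A r)))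
      (algebraMap k (FreeAlgebra k (A ⊕ g)) r)
  | base_add (a b : A) : Rel k A g (FreeAlgebra.ι k (.inl (a + b)))
      (FreeAlgebra.ι k (.inl a) + FreeAlgebra.ι k (.inl b))
  | base_mul (a b : A) : Rel k A g (FreeAlgebra.ι k (.inl (a * b)))
      (FreeAlgebra.ι k (.inl a) * FreeAlgebra.ι k (.inl b))
  | lie_add (X Y : g) : Rel k A g (FreeAlgebra.ι k (.inr (X + Y)))
      (FreeAlgebra.ι k (.inr X) + FreeAlgebra.ι k (.inr Y))
  | lie_smul (r : k) (X : g) : Rel k A g (FreeAlgebra.ι k (.inr (r • X)))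
      (r • FreeAlgebra.ι k (.inr X))
  | lie_bracket (X Y : g) : Rel k A g (FreeAlgebra.ι k (.inr ⁅X, Y⁆))
      (FreeAlgebra.ι k (.inr X) * FreeAlgebra.ι k (.inr Y)
        - FreeAlgebra.ι k (.inr Y) * FreeAlgebra.ι k (.inr X))
  | base_smul (a : A) (X : g) : Rel k A g (FreeAlgebra.ι k (.inr (a • X)))
      (FreeAlgebra.ι k (.inl a) * FreeAlgebra.ι k (.inr X))
  | anchor (X : g) (a : A) : Rel k A g
      (FreeAlgebra.ι k (.inr X) * FreeAlgebra.ι k (.inl a)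
        - FreeAlgebra.ι k (.inl a) * FreeAlgebra.ι k (.inr X))
      (FreeAlgebra.ι k (.inl ⁅X, a⁆))

end LRUniversalEnveloping

/-- The universal enveloping algebra `U_A(g)` of a Lie-Rinehart algebra `(A, g, ω)` over `k`. -/
def LRUniversalEnveloping (k A g : Type*) [CommRing k] [CommRing A] [Algebra k A] [LieRing g]
    [LieAlgebra k g] [Module A g] [LieRingModule g A] : Type _ :=
  RingQuot (LRUniversalEnveloping.Rel k A g)

namespace LRUniversalEnveloping

noncomputable section

section Basic

variable (k A g : Type*) [CommRing k] [CommRing A] [Algebra k A] [LieRing g]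
    [LieAlgebra k g] [Module A g] [LieRingModule g A]

instance instRing : Ring (LRUniversalEnveloping k A g) :=
  inferInstanceAs (Ring (RingQuot (Rel k A g)))

instance instAlgebra : Algebra k (LRUniversalEnveloping k A g) :=
  inferInstanceAs (Algebra k (RingQuot (Rel k A g)))

/-- The quotient map from the free algebra. -/
def mk : FreeAlgebra k (A ⊕ g) →ₐ[k] LRUniversalEnveloping k A g :=
  RingQuot.mkAlgHom k (Rel k A g)

variable {k A g} in
theorem mk_rel {x y : FreeAlgebra k (A ⊕ g)} (h : Rel k A g x y) : mk k A g x = mk k A g y :=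
  RingQuot.mkAlgHom_rel k h

/-- The algebra morphism `ι_A : A → U_A(g)`. -/
def ofBase : A →ₐ[k] LRUniversalEnveloping k A g :=
  AlgHom.mk'
    { toFun := fun a => mk k A g (FreeAlgebra.ι k (.inl a))
      map_one' := by
        have h := mk_rel (Rel.scalar (k := k) (A := A) (g := g) 1)
        simpa using h
      map_mul' := fun a b => by simpa using mk_rel (Rel.base_mul (k := k) (g := g) a b)
      map_zero' := by
        have h := mk_rel (Rel.scalar (k := k) (A := A) (g := g) 0)
        simpa using h
      map_add' := fun a b => by simpa using mk_rel (Rel.base_add (k := k) (g := g) a b) }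
    (fun r a => by
      have h := mk_rel (Rel.base_mul (k := k) (g := g) (algebraMap k A r) a)
      have h' := mk_rel (Rel.scalar (k := k) (A := A) (g := g) r)
      rw [map_mul, h', AlgHom.commutes] at h
      simpa [Algebra.smul_def] using h)

/-- The Lie algebra morphism `ι_g : g → U_A(g)`, as a `k`-linear map; see `ofLie_lie`. -/
def ofLie : g →ₗ[k] LRUniversalEnveloping k A g where
  toFun X := mk k A g (FreeAlgebra.ι k (.inr X))
  map_add' X Y := by simpa using mk_rel (Rel.lie_add (k := k) (A := A) X Y)
  map_smul' r X := by simpa using mk_rel (Rel.lie_smul (k := k) (A := A) r X)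

variable {k A g}

theorem ofLie_lie (X Y : g) : ofLie k A g ⁅X, Y⁆
    = ofLie k A g X * ofLie k A g Y - ofLie k A g Y * ofLie k A g X := by
  simpa [ofLie] using mk_rel (Rel.lie_bracket (k := k) (A := A) X Y)

theorem ofLie_smul (a : A) (X : g) :
    ofLie k A g (a • X) = ofBase k A g a * ofLie k A g X := by
  simpa [ofLie, ofBase] using mk_rel (Rel.base_smul (k := k) a X)

theorem ofLie_mul_ofBase (X : g) (a : A) :
    ofLie k A g X * ofBase k A g a
      = ofBase k A g a * ofLie k A g X + ofBase k A g ⁅X, a⁆ := by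
  have h := mk_rel (Rel.anchor (k := k) X a)
  rw [map_sub, map_mul, map_mul] at h
  exact sub_eq_iff_eq_add'.1 h

/-- The universal property of `U_A(g)`: existence. -/
def lift {R : Type*} [Ring R] [Algebra k R] (fA : A →ₐ[k] R) (fg : g →ₗ[k] R)
    (h_lie : ∀ X Y : g, fg ⁅X, Y⁆ = fg X * fg Y - fg Y * fg X)
    (h_smul : ∀ (a : A) (X : g), fg (a • X) = fA a * fg X)
    (h_anchor : ∀ (X : g) (a : A), fg X * fA a - fA a * fg X = fA ⁅X, a⁆) :
    LRUniversalEnveloping k A g →ₐ[k] R :=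
  RingQuot.liftAlgHom k
    ⟨FreeAlgebra.lift k (Sum.elim fA fg), by
      intro x y h
      induction h <;> simp [h_lie, h_smul, h_anchor]⟩

section lift

variable {R : Type*} [Ring R] [Algebra k R] (fA : A →ₐ[k] R) (fg : g →ₗ[k] R)
    (h_lie : ∀ X Y : g, fg ⁅X, Y⁆ = fg X * fg Y - fg Y * fg X)
    (h_smul : ∀ (a : A) (X : g), fg (a • X) = fA a * fg X)
    (h_anchor : ∀ (X : g) (a : A), fg X * fA a - fA a * fg X = fA ⁅X, a⁆)

theorem lift_ofBase (a : A) :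
    lift fA fg h_lie h_smul h_anchor (ofBase k A g a) = fA a := by
  refine (RingQuot.liftAlgHom_mkAlgHom_apply k _ _ _).trans ?_
  simp

theorem lift_ofLie (X : g) :
    lift fA fg h_lie h_smul h_anchor (ofLie k A g X) = fg X := by
  refine (RingQuot.liftAlgHom_mkAlgHom_apply k _ _ _).trans ?_
  simp

end lift

/-- The universal property of `U_A(g)`: uniqueness. -/
theorem hom_ext {R : Type*} [Ring R] [Algebra k R] {F G : LRUniversalEnveloping k A g →ₐ[k] R}
    (h₁ : ∀ a, F (ofBase k A g a) = G (ofBase k A g a))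
    (h₂ : ∀ X, F (ofLie k A g X) = G (ofLie k A g X)) : F = G := by
  refine RingQuot.ringQuot_ext' k F G (FreeAlgebra.hom_ext (funext fun s => ?_))
  cases s with
  | inl a => exact h₁ a
  | inr X => exact h₂ X

/-- The left `A`-module structure `a • u = ι_A(a) u`. -/
instance instModuleBase : Module A (LRUniversalEnveloping k A g) :=
  Module.compHom _ (ofBase k A g : A →+* LRUniversalEnveloping k A g)

theorem base_smul_def (a : A) (u : LRUniversalEnveloping k A g) :
    a • u = ofBase k A g a * u := rfl

instance instIsScalarTower : IsScalarTower k A (LRUniversalEnveloping k A g) where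
  smul_assoc r a u := by
    rw [base_smul_def, base_smul_def, map_smul, smul_mul_assoc]

theorem induction {p : LRUniversalEnveloping k A g → Prop} (one : p 1)
    (add : ∀ u v, p u → p v → p (u + v)) (smul : ∀ (a : A) u, p u → p (a • u))
    (lie : ∀ (X : g) u, p u → p (ofLie k A g X * u)) (u : LRUniversalEnveloping k A g) : p u := by
  suffices h : ∀ x : FreeAlgebra k (A ⊕ g), ∀ v, p v → p (mk k A g x * v) by
    obtain ⟨x, rfl⟩ := RingQuot.mkAlgHom_surjective k (Rel k A g) u
    have h' := h x 1 one
    rwa [mul_one] at h'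
  intro x
  induction x using FreeAlgebra.induction with
  | grade0 r =>
    intro v hv
    have h := smul (algebraMap k A r) v hv
    rwa [base_smul_def, AlgHom.commutes, ← AlgHom.commutes (mk k A g)] at h
  | grade1 s =>
    intro v hv
    cases s with
    | inl a => exact smul a v hv
    | inr X => exact lie X v hv
  | mul x y hx hy =>
    intro v hv
    rw [map_mul, mul_assoc]
    exact hx _ (hy _ hv)
  | add x y hx hy =>
    intro v hv
    rw [map_add, add_mul]
    exact add _ _ (hx _ hv) (hy _ hv)

end Basic

/-! ### The coalgebra structure

An operator `f` on an `A`-module with `f (a • m) = a • f m + δ a • m` is a derivation over `δ`.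
Two such operators over the same `δ` induce `m ⊗ n ↦ f m ⊗ n + m ⊗ h n` on the tensor product. -/

section Leibniz

variable {k A : Type*} [CommRing k] [CommRing A]
  {M N : Type*} [AddCommGroup M] [Module k M] [Module A M]
  [AddCommGroup N] [Module k N] [Module A N]

/-- The operator `m ⊗ n ↦ f m ⊗ n + m ⊗ h n` on `M ⊗[A] N`, as an additive map. -/
def leibnizTensorAux (δ : A → A) (f : Module.End k M) (h : Module.End k N)
    (hf : ∀ (a : A) m, f (a • m) = a • f m + δ a • m)
    (hh : ∀ (a : A) n, h (a • n) = a • h n + δ a • n) : M ⊗[A] N →+ M ⊗[A] N :=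
  TensorProduct.liftAddHom (R := A)
    (AddMonoidHom.mk' (fun m => AddMonoidHom.mk' (fun n => f m ⊗ₜ[A] n + m ⊗ₜ[A] h n)
      (fun n n' => by simp only [map_add, TensorProduct.tmul_add]; abel))
      (fun m m' => by
        ext n
        simp only [map_add, TensorProduct.add_tmul, AddMonoidHom.mk'_apply,
          AddMonoidHom.add_apply]
        abel))
    (fun a m n => by
      simp only [AddMonoidHom.mk'_apply, hf, hh, TensorProduct.add_tmul, TensorProduct.tmul_add,
        TensorProduct.smul_tmul]
      abel)

theorem leibnizTensorAux_tmul {δ : A → A} {f : Module.End k M} {h : Module.End k N}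
    {hf : ∀ (a : A) m, f (a • m) = a • f m + δ a • m}
    {hh : ∀ (a : A) n, h (a • n) = a • h n + δ a • n} (m : M) (n : N) :
    leibnizTensorAux δ f h hf hh (m ⊗ₜ n) = f m ⊗ₜ n + m ⊗ₜ h n := rfl

variable [Algebra k A] [IsScalarTower k A M]

/-- The operator `m ⊗ n ↦ f m ⊗ n + m ⊗ h n` on `M ⊗[A] N`. -/
def leibnizTensor (δ : A → A) (f : Module.End k M) (h : Module.End k N)
    (hf : ∀ (a : A) m, f (a • m) = a • f m + δ a • m)
    (hh : ∀ (a : A) n, h (a • n) = a • h n + δ a • n) : Module.End k (M ⊗[A] N) where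
  toFun := leibnizTensorAux δ f h hf hh
  map_add' := map_add _
  map_smul' := fun r x => by
    induction x using TensorProduct.induction_on with
    | zero => simp
    | tmul m n =>
      simp only [TensorProduct.smul_tmul', leibnizTensorAux_tmul, map_smul, smul_add,
        RingHom.id_apply]
    | add x y hx hy => rw [smul_add, map_add, hx, hy, map_add, smul_add]

variable {δ : A → A} {f : Module.End k M} {h : Module.End k N}
    {hf : ∀ (a : A) m, f (a • m) = a • f m + δ a • m}
    {hh : ∀ (a : A) n, h (a • n) = a • h n + δ a • n}

@[simp]
theorem leibnizTensor_tmul (m : M) (n : N) :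
    leibnizTensor δ f h hf hh (m ⊗ₜ n) = f m ⊗ₜ n + m ⊗ₜ h n := rfl

theorem leibnizTensor_smul (a : A) (x : M ⊗[A] N) :
    leibnizTensor δ f h hf hh (a • x) = a • leibnizTensor δ f h hf hh x + δ a • x := by
  induction x using TensorProduct.induction_on with
  | zero => simp
  | tmul m n =>
    simp only [TensorProduct.smul_tmul', leibnizTensor_tmul, hf, TensorProduct.add_tmul, smul_add]
    abel
  | add x y hx hy => simp only [smul_add, map_add, hx, hy]; abel

end Leibniz

section Coalgebra

variable {k A g : Type*} [CommRing k] [CommRing A] [Algebra k A] [LieRing g]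
    [LieAlgebra k g] [Module A g] [LieRingModule g A]

variable (k A) in
/-- Left multiplication by `X` on `U_A(g)`. -/
def lieMul (X : g) : Module.End k (LRUniversalEnveloping k A g) :=
  LinearMap.mulLeft k (ofLie k A g X)

theorem lieMul_apply (X : g) (u : LRUniversalEnveloping k A g) :
    lieMul k A X u = ofLie k A g X * u := rfl

theorem lieMul_smul (X : g) (a : A) (u : LRUniversalEnveloping k A g) :
    lieMul k A X (a • u) = a • lieMul k A X u + ⁅X, a⁆ • u := by
  simp only [lieMul_apply, base_smul_def, ← mul_assoc, ofLie_mul_ofBase, add_mul]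

variable (k A) in
/-- The diagonal action `u ⊗ v ↦ X u ⊗ v + u ⊗ X v` of `X` on `U ⊗[A] U`. -/
def lieTensor (X : g) :
    Module.End k (LRUniversalEnveloping k A g ⊗[A] LRUniversalEnveloping k A g) :=
  leibnizTensor (fun a => ⁅X, a⁆) (lieMul k A X) (lieMul k A X) (lieMul_smul X) (lieMul_smul X)

theorem lieTensor_tmul (X : g) (u v : LRUniversalEnveloping k A g) :
    lieTensor k A X (u ⊗ₜ v) = (ofLie k A g X * u) ⊗ₜ v + u ⊗ₜ (ofLie k A g X * v) := rfl

variable (k A g) in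
/-- The action of `U_A(g)` on `U ⊗[A] U` that extends the diagonal action of `g`. -/
def tensorAction : LRUniversalEnveloping k A g →ₐ[k]
    Module.End k (LRUniversalEnveloping k A g ⊗[A] LRUniversalEnveloping k A g) :=
  lift (Algebra.lsmul k k _)
    { toFun := lieTensor k A
      map_add' := fun X Y => by
        ext x
        induction x using TensorProduct.induction_on with
        | zero => simp
        | tmul u v =>
          simp only [lieTensor_tmul, LinearMap.add_apply, map_add, add_mul,
            TensorProduct.add_tmul, TensorProduct.tmul_add]
          abel
        | add x y hx hy => simp only [map_add, hx, hy]
      map_smul' := fun r X => by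
        ext x
        induction x using TensorProduct.induction_on with
        | zero => simp
        | tmul u v =>
          simp only [lieTensor_tmul, LinearMap.smul_apply, map_smul, smul_mul_assoc,
            RingHom.id_apply, smul_add, TensorProduct.smul_tmul', TensorProduct.tmul_smul]
        | add x y hx hy => simp only [map_add, hx, hy] }
    (fun X Y => by
      ext x
      induction x using TensorProduct.induction_on with
      | zero => simp
      | tmul u v =>
        simp only [lieTensor_tmul, LinearMap.coe_mk, AddHom.coe_mk, LinearMap.sub_apply,
          Module.End.mul_apply, ofLie_lie, map_add, sub_mul, TensorProduct.sub_tmul,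
          TensorProduct.tmul_sub, mul_assoc]
        abel
      | add x y hx hy => simp only [map_add, hx, hy])
    (fun a X => by
      ext x
      induction x using TensorProduct.induction_on with
      | zero => simp
      | tmul u v =>
        simp only [lieTensor_tmul, LinearMap.coe_mk, AddHom.coe_mk, Module.End.mul_apply,
          Algebra.lsmul_coe, ofLie_smul, mul_assoc, smul_add]
        rw [← base_smul_def, ← base_smul_def, TensorProduct.smul_tmul', TensorProduct.tmul_smul]
      | add x y hx hy => simp only [map_add, hx, hy])
    (fun X a => by
      ext x
      simp only [LinearMap.coe_mk, AddHom.coe_mk, Module.End.mul_apply, Algebra.lsmul_coe,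
        LinearMap.sub_apply]
      rw [lieTensor, leibnizTensor_smul, add_sub_cancel_left])

variable (k A g) in
/-- The comultiplication `Δ : U → U ⊗[A] U`: the left `A`-linear map with `Δ(1) = 1 ⊗ 1` and
`Δ(X u) = (X ⊗ 1 + 1 ⊗ X) Δ(u)`; see `comul_one` and `comul_lie_mul`. -/
def comul : LRUniversalEnveloping k A g →ₗ[A]
    LRUniversalEnveloping k A g ⊗[A] LRUniversalEnveloping k A g where
  toFun u := tensorAction k A g u (1 ⊗ₜ 1)
  map_add' u v := by simp
  map_smul' a u := by
    rw [base_smul_def, map_mul, Module.End.mul_apply, tensorAction, lift_ofBase]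
    rfl

theorem comul_one : comul k A g 1 = 1 ⊗ₜ 1 := by simp [comul]

theorem comul_lie_mul (X : g) (u : LRUniversalEnveloping k A g) :
    comul k A g (ofLie k A g X * u) = lieTensor k A X (comul k A g u) := by
  simp only [comul, LinearMap.coe_mk, AddHom.coe_mk, map_mul, Module.End.mul_apply]
  rw [tensorAction, lift_ofLie]
  rfl

theorem coassoc_aux (u : LRUniversalEnveloping k A g) :
    TensorProduct.assoc A _ _ _ ((comul k A g).rTensor _ (comul k A g u))
      = (comul k A g).lTensor _ (comul k A g u) := by
  induction u using induction with
  | one => simp [comul_one]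
  | add u v hu hv => simp only [map_add, hu, hv]
  | smul a u hu => simp only [map_smul, hu]
  | lie X u hu =>
    -- the diagonal operators of `X` on the two triple tensor products
    let D₁ := leibnizTensor (fun a => ⁅X, a⁆) (lieTensor k A X) (lieMul k A X)
      (leibnizTensor_smul (hf := lieMul_smul X) (hh := lieMul_smul X)) (lieMul_smul X)
    let D₂ := leibnizTensor (fun a => ⁅X, a⁆) (lieMul k A X) (lieTensor k A X)
      (lieMul_smul X) (leibnizTensor_smul (hf := lieMul_smul X) (hh := lieMul_smul X))
    have hD₁ : ∀ x w, D₁ (x ⊗ₜ w) = lieTensor k A X x ⊗ₜ w + x ⊗ₜ (ofLie k A g X * w) :=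
      fun _ _ => rfl
    have hD₂ : ∀ w x, D₂ (w ⊗ₜ x) = (ofLie k A g X * w) ⊗ₜ x + w ⊗ₜ lieTensor k A X x :=
      fun _ _ => rfl
    have h₁ : ∀ t, (comul k A g).rTensor _ (lieTensor k A X t)
        = D₁ ((comul k A g).rTensor _ t) := by
      intro t
      induction t using TensorProduct.induction_on with
      | zero => simp
      | tmul u v => simp [hD₁, lieTensor_tmul, comul_lie_mul]
      | add x y hx hy => simp only [map_add, hx, hy]
    have h₂ : ∀ t, (comul k A g).lTensor _ (lieTensor k A X t)
        = D₂ ((comul k A g).lTensor _ t) := by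
      intro t
      induction t using TensorProduct.induction_on with
      | zero => simp
      | tmul u v => simp [hD₂, lieTensor_tmul, comul_lie_mul]
      | add x y hx hy => simp only [map_add, hx, hy]
    have h₃ : ∀ t, TensorProduct.assoc A _ _ _ (D₁ t) = D₂ (TensorProduct.assoc A _ _ _ t) := by
      intro t
      induction t using TensorProduct.induction_on with
      | zero => simp
      | tmul x w =>
        induction x using TensorProduct.induction_on with
        | zero => simp
        | tmul u v =>
          simp only [hD₁, hD₂, lieTensor_tmul, TensorProduct.assoc_tmul, TensorProduct.add_tmul,
            TensorProduct.tmul_add, map_add]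
          abel
        | add x y hx hy => simp only [TensorProduct.add_tmul, map_add, hx, hy]
      | add x y hx hy => simp only [map_add, hx, hy]
    rw [comul_lie_mul, h₁, h₂, h₃, hu]

variable [LieRinehartRing A g] [LieRinehartAlgebra k A g]

variable (k A g) in
/-- The action of `U_A(g)` on `A` that extends multiplication and the anchor. -/
def baseAction : LRUniversalEnveloping k A g →ₐ[k] Module.End k A :=
  lift (Algebra.lmul k A) (LieModule.toEnd k g A : g →ₗ[k] Module.End k A)
    (fun X Y => by ext a; simp)
    (fun a X => by ext b; simp)
    (fun X a => by ext b; simp)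

variable (k A g) in
/-- The counit `ε : U → A`: the left `A`-linear map with `ε(1) = 1` and `ε(X u) = ω(X)(ε(u))`;
in particular `ε(X₁ ⋯ Xₙ) = 0` for `n ≥ 1`. -/
def counit : LRUniversalEnveloping k A g →ₗ[A] A where
  toFun u := baseAction k A g u 1
  map_add' u v := by simp
  map_smul' a u := by
    rw [base_smul_def, map_mul, Module.End.mul_apply, baseAction, lift_ofBase]
    rfl

theorem counit_one : counit k A g 1 = 1 := by simp [counit]

theorem counit_lie_mul (X : g) (u : LRUniversalEnveloping k A g) :
    counit k A g (ofLie k A g X * u) = ⁅X, counit k A g u⁆ := by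
  simp only [counit, LinearMap.coe_mk, AddHom.coe_mk, map_mul, Module.End.mul_apply]
  rw [baseAction, lift_ofLie]
  rfl

theorem rTensor_counit_aux (u : LRUniversalEnveloping k A g) :
    (counit k A g).rTensor _ (comul k A g u) = 1 ⊗ₜ[A] u := by
  induction u using induction with
  | one => simp [comul_one, counit_one]
  | add u v hu hv => simp only [map_add, hu, hv, TensorProduct.tmul_add]
  | smul a u hu => simp only [map_smul, hu, TensorProduct.tmul_smul]
  | lie X u hu =>
    let D := leibnizTensor (k := k) (fun a => ⁅X, a⁆) (LieModule.toEnd k g A X) (lieMul k A X)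
      (fun a b => by simp) (lieMul_smul X)
    have h : ∀ t, (counit k A g).rTensor _ (lieTensor k A X t)
        = D ((counit k A g).rTensor _ t) := by
      intro t
      induction t using TensorProduct.induction_on with
      | zero => simp
      | tmul u v => simp [D, lieTensor_tmul, counit_lie_mul, lieMul_apply]
      | add x y hx hy => simp only [map_add, hx, hy]
    have h1 : ⁅X, (1 : A)⁆ = 0 := by
      simpa using LieRinehartRing.leibniz_mul_right X (1 : A) 1
    rw [comul_lie_mul, h, hu]
    simp [D, h1, lieMul_apply]

theorem lTensor_counit_aux (u : LRUniversalEnveloping k A g) :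
    (counit k A g).lTensor _ (comul k A g u) = u ⊗ₜ[A] 1 := by
  induction u using induction with
  | one => simp [comul_one, counit_one]
  | add u v hu hv => simp only [map_add, hu, hv, TensorProduct.add_tmul]
  | smul a u hu => simp only [map_smul, hu, TensorProduct.smul_tmul']
  | lie X u hu =>
    let D := leibnizTensor (k := k) (fun a => ⁅X, a⁆) (lieMul k A X) (LieModule.toEnd k g A X)
      (lieMul_smul X) (fun a b => by simp)
    have h : ∀ t, (counit k A g).lTensor _ (lieTensor k A X t)
        = D ((counit k A g).lTensor _ t) := by
      intro t
      induction t using TensorProduct.induction_on with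
      | zero => simp
      | tmul u v => simp [D, lieTensor_tmul, counit_lie_mul, lieMul_apply]
      | add x y hx hy => simp only [map_add, hx, hy]
    have h1 : ⁅X, (1 : A)⁆ = 0 := by
      simpa using LieRinehartRing.leibniz_mul_right X (1 : A) 1
    rw [comul_lie_mul, h, hu]
    simp [D, h1, lieMul_apply]

/-- The `A`-coalgebra structure of `U_A(g)`, over the left `A`-module structure. -/
instance instCoalgebra : Coalgebra A (LRUniversalEnveloping k A g) where
  comul := comul k A g
  counit := counit k A g
  coassoc := LinearMap.ext coassoc_aux
  rTensor_counit_comp_comul := LinearMap.ext rTensor_counit_aux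
  lTensor_counit_comp_comul := LinearMap.ext lTensor_counit_aux

end Coalgebra

end

end LRUniversalEnveloping

/-! ### Projective bases and the symmetrisation map -/

/-- A projective (dual) basis `{χ_i, φ_i}` of an `A`-module `g`. -/
structure ProjectiveBasis (I A g : Type*) [CommRing A] [AddCommGroup g] [Module A g] where
  /-- the generators `χ_i` -/
  gen : I → g
  /-- the linear forms `φ_i` -/
  form : I → g →ₗ[A] A
  finite_support : ∀ X : g, (Function.support fun i => form i X).Finite
  sum_form_smul_gen : ∀ X : g, ∑ᶠ i, form i X • gen i = X

namespace ProjectiveBasis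

noncomputable section

/-- Every projective module has a projective basis. -/
theorem exists_of_projective (A g : Type*) [CommRing A] [AddCommGroup g] [Module A g]
    [Module.Projective A g] : Nonempty (ProjectiveBasis g A g) := by
  obtain ⟨s, hs⟩ := (Module.projective_def' (R := A) (P := g)).1 inferInstance
  refine ⟨⟨id, fun i => Finsupp.lapply i ∘ₗ s, fun X => (s X).hasFiniteSupport, fun X => ?_⟩⟩
  have h := LinearMap.congr_fun hs X
  simp only [LinearMap.comp_apply, Finsupp.linearCombination_apply, LinearMap.id_apply] at h
  rw [Finsupp.sum] at h
  conv_rhs => rw [← h]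
  refine finsum_eq_sum_of_support_subset _ fun i hi => ?_
  simp only [Function.mem_support, Finsupp.lapply_apply, LinearMap.comp_apply] at hi
  simp only [Finset.mem_coe, Finsupp.mem_support_iff]
  exact fun h0 => hi (by rw [h0, zero_smul])

variable {I A g : Type*} [CommRing A] [AddCommGroup g] [Module A g] (b : ProjectiveBasis I A g)

/-- The finite set of the indices `i` with `φ_i(X) ≠ 0`. -/
def supp (X : g) : Finset I := (b.finite_support X).toFinset

/-- The morphism `S_A(g) → A[x_i | i ∈ I]` of `A`-algebras with `X ↦ ∑ φ_i(X) x_i`. -/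
def toPolynomial : SymmetricAlgebra A g →ₐ[A] MvPolynomial I A :=
  SymmetricAlgebra.lift
    { toFun := fun X => ∑ᶠ i, b.form i X • MvPolynomial.X i
      map_add' := fun X Y => by
        simp only [map_add, add_smul]
        exact finsum_add_distrib
          ((b.finite_support X).subset fun i hi h0 => hi (by simp only at h0; simp [h0]))
          ((b.finite_support Y).subset fun i hi h0 => hi (by simp only at h0; simp [h0]))
      map_smul' := fun a X => by
        simp only [map_smul, smul_assoc, RingHom.id_apply]
        exact (smul_finsum' a
          ((b.finite_support X).subset fun i hi h0 => hi (by simp only at h0; simp [h0]))).symm }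

/-- The average `(1/n!) ∑_σ u_{σ(1)} ⋯ u_{σ(n)}` of the products of `u_1, …, u_n` in all orders. -/
def averagedProduct (k : Type*) [Field k] {U : Type*} [Ring U] [Algebra k U] {n : ℕ}
    (u : Fin n → U) : U :=
  (n.factorial : k)⁻¹ • ∑ σ : Equiv.Perm (Fin n), (List.ofFn fun i => u (σ i)).prod

end

end ProjectiveBasis

namespace ProjectiveBasis

noncomputable section

variable {I A g : Type*} [CommRing A] [LieRing g] [Module A g] (b : ProjectiveBasis I A g)
  (k : Type*) [Field k] [Algebra k A] [LieAlgebra k g] [LieRingModule g A]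

open LRUniversalEnveloping

/-- The `A`-linear map `A[x_i | i ∈ I] → U_A(g)` that sends a monomial `x_{j_1} ⋯ x_{j_n}` to
the average of the products of `χ_{j_1}, …, χ_{j_n}` in all orders. -/
def averageMonomials : MvPolynomial I A →ₗ[A] LRUniversalEnveloping k A g :=
  (MvPolynomial.basisMonomials I A).constr A fun m =>
    averagedProduct k fun i => ofLie k A g (b.gen (m.toMultiset.toList.get i))

/-- The symmetrisation map `S_A(g) → U_A(g)` of a projective basis; it is characterised by
`symmetrisation_prod`. -/
def symmetrisation : SymmetricAlgebra A g →ₗ[A] LRUniversalEnveloping k A g :=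
  b.averageMonomials k ∘ₗ b.toPolynomial.toLinearMap

theorem averagedProduct_comp_equiv {U : Type*} [Ring U] [Algebra k U] {m n : ℕ}
    (e : Fin m ≃ Fin n) (u : Fin n → U) :
    averagedProduct k (fun i => u (e i)) = averagedProduct k u := by
  obtain rfl : m = n := by simpa using Fintype.card_congr e
  unfold averagedProduct
  congr 1
  exact Fintype.sum_equiv (Equiv.mulLeft e) _ _ fun σ => rfl

theorem averagedProduct_congr {U : Type*} [Ring U] [Algebra k U] {l : List I} {n : ℕ}
    (j : Fin n → I) (h : l.Perm (List.ofFn j)) (f : I → U) :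
    averagedProduct k (fun i => f (l.get i)) = averagedProduct k (fun i => f (j i)) := by
  classical
  let e : Fin l.length ≃ Fin (List.ofFn j).length :=
    ⟨h.idxBij, h.symm.idxBij, h.symm.idxBij_leftInverse_idxBij_symm,
      h.symm.idxBij_rightInverse_idxBij_symm⟩
  have he : ∀ i, j (finCongr (List.length_ofFn (f := j)) (e i)) = l.get i := fun i => by
    have h' := h.getElem_idxBij_eq_getElem (i := i)
    rw [List.getElem_ofFn] at h'
    exact h'
  rw [← averagedProduct_comp_equiv k (e.trans (finCongr (List.length_ofFn (f := j))))]
  simp only [Equiv.trans_apply, he]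

theorem averageMonomials_prod {n : ℕ} (j : Fin n → I) :
    b.averageMonomials k (∏ i, MvPolynomial.X (j i))
      = averagedProduct k fun i => ofLie k A g (b.gen (j i)) := by
  have h : (∏ i, MvPolynomial.X (j i) : MvPolynomial I A)
      = MvPolynomial.basisMonomials I A (∑ i, Finsupp.single (j i) 1) := by
    rw [MvPolynomial.coe_basisMonomials]
    exact (MvPolynomial.monomial_sum_one _ _).symm
  rw [h, averageMonomials, Module.Basis.constr_basis]
  refine averagedProduct_congr k j ?_ fun i => ofLie k A g (b.gen i)
  rw [← Multiset.coe_eq_coe, Multiset.coe_toList, ← Fin.univ_val_map, Finsupp.toMultiset_sum]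
  simp only [Finsupp.toMultiset_single, one_smul]
  rw [← Multiset.sum_map_singleton (Multiset.map j Finset.univ.val), Multiset.map_map]
  rfl

/-- The defining formula of the symmetrisation map, for `n ≥ 0`. -/
theorem symmetrisation_prod {n : ℕ} (X : Fin n → g) :
    b.symmetrisation k (∏ i, SymmetricAlgebra.ι A g (X i))
      = (n.factorial : k)⁻¹ • ∑ j ∈ Fintype.piFinset fun i => b.supp (X i),
          ∑ σ : Equiv.Perm (Fin n), (∏ i, b.form (j i) (X i)) •
            (List.ofFn fun i => ofLie k A g (b.gen (j (σ i)))).prod := by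
  have h : ∀ Y : g, b.toPolynomial (SymmetricAlgebra.ι A g Y)
      = ∑ i ∈ b.supp Y, b.form i Y • MvPolynomial.X i := fun Y => by
    rw [toPolynomial, SymmetricAlgebra.lift_ι_apply]
    refine finsum_eq_sum_of_support_subset _ fun i hi => ?_
    simp only [supp, Set.Finite.coe_toFinset]
    exact fun h0 => hi (by simp only at h0; simp [h0])
  simp only [symmetrisation, LinearMap.comp_apply, AlgHom.toLinearMap_apply, map_prod, h,
    Finset.prod_univ_sum, Finset.prod_smul, map_sum, map_smul, averageMonomials_prod,
    averagedProduct]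
  rw [Finset.smul_sum]
  refine Finset.sum_congr rfl fun j _ => ?_
  rw [smul_comm, Finset.smul_sum]

end

end ProjectiveBasis

/-! Filter both algebras by the length of words. Reordering a word in U changes it by a combination
of shorter words, so S sends X f to X S(f) up to lower order. Surjectivity follows by induction on
the filtration. Injectivity is the PBW theorem: it needs an A-linear `symbol` from U to the
symmetric algebra that is also multiplicative up to lower order, for then `symbol` ∘ S is the
identity up to lower order, and an element killed by S descends through the filtration to 0.

If a Lie–Rinehart algebra L is free over A with an ordered basis, such a map comes from the
classical PBW action of L on polynomials, in which X acts as multiplication by X up to lower degree;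
here X also differentiates the coefficients through the anchor. The action is defined by recursion
on degree so that its curvature `defect` vanishes where the letters are in order. Elsewhere
`defect_mono` deduces the vanishing from the Jacobi identity.

A projective g is first embedded in a free L. A complement of g in a free module has no evident flat
g-action, but a free module has one: the anchor applied to coefficients. Hence the semidirect
product of g with a countable sum of copies of a free module F containing g as a summand is
Lie–Rinehart, and the Eilenberg swindle makes it free as a module. Its projection to g carries
polynomials to the symmetric algebra.

For the coring structure, polarisation in characteristic 0 shows that the powers of sums of
variables span A[x_i] over A. Since S is the composite of an algebra and coalgebra map into A[x_i]
with `averageMonomials`, it is enough to treat these powers. There averaging is invisible: (∑ x_i)^n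
goes to (∑ χ_i)^n (`averageMonomials_sum_pow`), and both comultiplications are given by the binomial
formula. -/

/-! ### The action of a free Lie-Rinehart algebra on polynomials -/

namespace LRFreeAction

noncomputable section

/-- The polynomials in the variables `J`, as combinations of multisets. -/
def Poly (J A : Type*) [CommRing A] : Type _ := Multiset J →₀ A

instance (J A : Type*) [CommRing A] : AddCommGroup (Poly J A) :=
  inferInstanceAs (AddCommGroup (Multiset J →₀ A))

instance (J A : Type*) [CommRing A] : Module A (Poly J A) :=
  inferInstanceAs (Module A (Multiset J →₀ A))

instance (k J A : Type*) [CommRing k] [CommRing A] [Algebra k A] : Module k (Poly J A) :=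
  Module.compHom (Poly J A) (algebraMap k A)

instance (k J A : Type*) [CommRing k] [CommRing A] [Algebra k A] :
    IsScalarTower k A (Poly J A) where
  smul_assoc r a f := by
    rw [Algebra.smul_def, mul_smul]
    rfl

/-! ### Polynomials filtered by degree. -/

section Filtration

variable (J A : Type*) [CommRing A]

/-- The basis of monomials. -/
def monomials : Module.Basis (Multiset J) A (Poly J A) := .ofRepr (LinearEquiv.refl A _)

variable {J A}

/-- The monomial of a multiset. -/
def mono (m : Multiset J) : Poly J A := monomials J A m

variable (J A) in
/-- The polynomials of degree at most `n`. -/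
def polyLE (n : ℕ) : Submodule A (Poly J A) :=
  Submodule.span A (mono '' {m : Multiset J | m.card ≤ n})

theorem mono_mem_polyLE {m : Multiset J} {n : ℕ} (h : m.card ≤ n) :
    (mono m : Poly J A) ∈ polyLE J A n :=
  Submodule.subset_span ⟨m, h, rfl⟩

theorem polyLE_mono {m n : ℕ} (h : m ≤ n) : polyLE J A m ≤ polyLE J A n :=
  Submodule.span_mono (Set.image_mono fun _ hx => le_trans hx h)

theorem polyLE_induction {n : ℕ} {p : (f : Poly J A) → f ∈ polyLE J A n → Prop}
    (hmono : ∀ (m : Multiset J) (hm : m.card ≤ n), p (mono m) (mono_mem_polyLE hm))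
    (hzero : p 0 (zero_mem _))
    (hadd : ∀ f f' hf hf', p f hf → p f' hf' → p (f + f') (add_mem hf hf'))
    (hsmul : ∀ (a : A) f hf, p f hf → p (a • f) (Submodule.smul_mem _ a hf))
    {f : Poly J A} (hf : f ∈ polyLE J A n) : p f hf := by
  induction hf using Submodule.span_induction with
  | mem x hx => obtain ⟨m, hm, rfl⟩ := hx; exact hmono m hm
  | zero => exact hzero
  | add x y _ _ hx hy => exact hadd _ _ _ _ hx hy
  | smul a x _ hx => exact hsmul _ _ _ hx

theorem exists_mem_polyLE (f : Poly J A) : ∃ n, f ∈ polyLE J A n := by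
  have hf := (monomials J A).mem_span f
  induction hf using Submodule.span_induction with
  | mem x hx => obtain ⟨m, rfl⟩ := hx; exact ⟨m.card, mono_mem_polyLE le_rfl⟩
  | zero => exact ⟨0, zero_mem _⟩
  | add x y _ _ hx hy =>
    obtain ⟨m, hm⟩ := hx
    obtain ⟨n, hn⟩ := hy
    exact ⟨max m n, add_mem (polyLE_mono (le_max_left m n) hm) (polyLE_mono (le_max_right m n) hn)⟩
  | smul a x _ hx =>
    obtain ⟨m, hm⟩ := hx
    exact ⟨m, Submodule.smul_mem _ _ hm⟩

/-- Multiplication by the variable `i`. -/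
def mulVar (i : J) : Poly J A →ₗ[A] Poly J A :=
  (monomials J A).constr A fun m => mono (i ::ₘ m)

@[simp]
theorem mulVar_mono (i : J) (m : Multiset J) : mulVar i (mono m : Poly J A) = mono (i ::ₘ m) := by
  rw [mulVar, mono, Module.Basis.constr_basis]

theorem mulVar_mem {i : J} {n : ℕ} {f : Poly J A} (hf : f ∈ polyLE J A n) :
    mulVar i f ∈ polyLE J A (n + 1) := by
  induction hf using polyLE_induction with
  | hmono m hm => rw [mulVar_mono]; exact mono_mem_polyLE (by simpa using hm)
  | hzero => simp
  | hadd f f' _ _ hf hf' => rw [map_add]; exact add_mem hf hf'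
  | hsmul a f _ hf => rw [map_smul]; exact Submodule.smul_mem _ _ hf

end Filtration

section Basis

variable {A L J : Type*} [CommRing A] [AddCommGroup L] [Module A L] (b : Module.Basis J A L)

theorem basis_induction (b : Module.Basis J A L) {p : L → Prop} (hb : ∀ i, p (b i)) (hzero : p 0)
    (hadd : ∀ X Y, p X → p Y → p (X + Y)) (hsmul : ∀ (a : A) X, p X → p (a • X)) (X : L) : p X := by
  have hX : X ∈ Submodule.span A (Set.range b) := b.mem_span X
  induction hX using Submodule.span_induction with
  | mem x hx => obtain ⟨i, rfl⟩ := hx; exact hb i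
  | zero => exact hzero
  | add x y _ _ hx hy => exact hadd _ _ hx hy
  | smul a x _ hx => exact hsmul _ _ hx

/-- Multiplication by the linear form of an element of `L`. -/
def mulLinear : L →ₗ[A] Module.End A (Poly J A) := b.constr A mulVar

theorem mulLinear_mem (X : L) {n : ℕ} {f : Poly J A} (hf : f ∈ polyLE J A n) :
    mulLinear b X f ∈ polyLE J A (n + 1) := by
  induction X using basis_induction b with
  | hb i => rw [mulLinear, Module.Basis.constr_basis]; exact mulVar_mem hf
  | hzero => simp
  | hadd X Y hX hY => rw [map_add]; exact add_mem hX hY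
  | hsmul a X hX => rw [map_smul]; exact Submodule.smul_mem _ _ hX

end Basis

/-! ### The PBW action, defined by recursion on the degree. -/

section Action

variable {k A L J : Type*} [CommRing k] [CommRing A] [Algebra k A] [LieRing L] [LieAlgebra k L]
  [Module A L] [LieRingModule L A] [LieRinehartRing A L] [LieRinehartAlgebra k A L]

variable (k A J) in
/-- The action of `X` on the coefficients of polynomials through the anchor. -/
def coeffAction (X : L) : Module.End k (Poly J A) :=
  ((monomials J A).repr.symm.toLinearMap.restrictScalars k) ∘ₗ
    Finsupp.mapRange.linearMap (LieModule.toEnd k L A X) ∘ₗ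
      ((monomials J A).repr.toLinearMap.restrictScalars k)

theorem lie_one (X : L) : ⁅X, (1 : A)⁆ = 0 := by
  simpa using LieRinehartRing.leibniz_mul_right X (1 : A) 1

theorem coeffAction_mono (X : L) (m : Multiset J) : coeffAction k A J X (mono m) = 0 := by
  simp [coeffAction, mono, lie_one]

theorem coeffAction_smul (X : L) (a : A) (f : Poly J A) :
    coeffAction k A J X (a • f) = a • coeffAction k A J X f + ⁅X, a⁆ • f := by
  apply (monomials J A).repr.injective
  ext m
  simp [coeffAction]

variable (k) in
/-- The operator with prescribed values `v` on monomials that is a derivation over `X`. -/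
def leibnizExtend (X : L) (v : Multiset J → Poly J A) : Module.End k (Poly J A) :=
  ((monomials J A).constr A v).restrictScalars k + coeffAction k A J X

theorem leibnizExtend_mono (X : L) (v : Multiset J → Poly J A) (m : Multiset J) :
    leibnizExtend k X v (mono m) = v m := by
  rw [leibnizExtend, LinearMap.add_apply, coeffAction_mono, add_zero, mono,
    LinearMap.restrictScalars_apply, Module.Basis.constr_basis]

theorem leibnizExtend_smul (X : L) (v : Multiset J → Poly J A) (a : A) (f : Poly J A) :
    leibnizExtend k X v (a • f) = a • leibnizExtend k X v f + ⁅X, a⁆ • f := by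
  simp only [leibnizExtend, LinearMap.add_apply, coeffAction_smul, LinearMap.restrictScalars_apply,
    map_smul, smul_add, add_assoc]

theorem leibnizExtend_congr (X : L) {v w : Multiset J → Poly J A} {n : ℕ}
    (h : ∀ m, m.card ≤ n → v m = w m) {f : Poly J A} (hf : f ∈ polyLE J A n) :
    leibnizExtend k X v f = leibnizExtend k X w f := by
  induction hf using polyLE_induction with
  | hmono m hm => simp only [leibnizExtend_mono, h m hm]
  | hzero => simp
  | hadd f f' _ _ hf hf' => simp only [map_add, hf, hf']
  | hsmul a f _ hf => simp only [leibnizExtend_smul, hf]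

/-- The derivation term only changes coefficients, so it does not raise the degree: the leading part
of the operator is decided on monomials. -/
theorem leibnizExtend_sub_mulVar_mem {i : J} {v : Multiset J → Poly J A} {n : ℕ}
    (hv : ∀ m : Multiset J, m.card ≤ n → v m - mono (i ::ₘ m) ∈ polyLE J A m.card)
    {d : ℕ} (hd : d ≤ n) {f : Poly J A} (hf : f ∈ polyLE J A d) (X : L) :
    leibnizExtend k X v f - mulVar i f ∈ polyLE J A d := by
  induction hf using polyLE_induction with
  | hmono m hm =>
    rw [leibnizExtend_mono, mulVar_mono]
    exact polyLE_mono hm (hv m (hm.trans hd))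
  | hzero => simp
  | hadd f f' _ _ hf hf' =>
    rw [map_add, map_add, add_sub_add_comm]
    exact add_mem hf hf'
  | hsmul a f hf ih =>
    rw [leibnizExtend_smul, map_smul, add_sub_right_comm, ← smul_sub]
    exact add_mem (Submodule.smul_mem _ _ ih) (Submodule.smul_mem _ _ hf)

variable [LinearOrder J] (b : Module.Basis J A L)

variable (k) in
open Classical in
/-- The value of the basis vector `i` on the monomial of `m`, correct for `m.card ≤ n`. -/
def stageValue : ℕ → J → Multiset J → Poly J A
  | 0, i, m => mono (i ::ₘ m)
  | n + 1, i, m =>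
    -- Stages, rather than a recursion on `m`, are used because `leibnizExtend` needs a whole
    -- function of monomials as its input.
    if m.card ≤ n then stageValue n i m
    else if h : ∃ j ∈ m, j < i ∧ ∀ l ∈ m, j ≤ l then
      -- With m = x_j m', flatness forces X_i (x_j m') = X_j (X_i m') + [X_i, X_j] m'. Write X_i m'
      -- = x_i m' + w with w of degree at most that of m'; since j is least, X_j (x_i m') = x_j x_i
      -- m' = x_i m, and X_j w is already known.
      mono (i ::ₘ m)
        + leibnizExtend k (b h.choose) (stageValue n h.choose)
          (stageValue n i (m.erase h.choose) - mono (i ::ₘ m.erase h.choose))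
        + Finsupp.linearCombination A (fun l => stageValue n l (m.erase h.choose))
          (b.repr ⁅b i, b h.choose⁆)
    else mono (i ::ₘ m)

variable (k) in
/-- The value of the basis vector `i` on the monomial of `m`. -/
def value (i : J) (m : Multiset J) : Poly J A := stageValue k b m.card i m

theorem stageValue_eq_value {n : ℕ} (i : J) {m : Multiset J} (h : m.card ≤ n) :
    stageValue k b n i m = value k b i m := by
  induction n with
  | zero => rw [value, Nat.le_zero.1 h]
  | succ n ih =>
    rcases h.eq_or_lt with h | h
    · rw [value, h]
    · rw [stageValue, if_pos (by omega), ih (by omega)]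

theorem value_of_le {i : J} {m : Multiset J} (h : ∀ l ∈ m, i ≤ l) :
    value k b i m = mono (i ::ₘ m) := by
  rw [value]
  rcases hn : m.card with _ | n
  · rfl
  · rw [stageValue, if_neg (by omega), dif_neg]
    rintro ⟨j, hj, hji, -⟩
    exact absurd (h j hj) (not_le.2 hji)

theorem value_cons_aux {i j : J} {m : Multiset J} (hji : j < i) (h : ∀ l ∈ m, j ≤ l) :
    value k b i (j ::ₘ m) = mono (i ::ₘ j ::ₘ m)
      + leibnizExtend k (b j) (stageValue k b m.card j)
          (value k b i m - mono (i ::ₘ m))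
      + Finsupp.linearCombination A (fun l => value k b l m) (b.repr ⁅b i, b j⁆) := by
  have hex : ∃ j' ∈ j ::ₘ m, j' < i ∧ ∀ l ∈ j ::ₘ m, j' ≤ l :=
    ⟨j, Multiset.mem_cons_self j m, hji, by simpa using h⟩
  -- The chosen letter is a minimum of the multiset, hence unique.
  have hj : hex.choose = j := by
    obtain ⟨h1, h2, h3⟩ := hex.choose_spec
    refine le_antisymm (h3 _ (Multiset.mem_cons_self j m)) ?_
    rcases Multiset.mem_cons.1 h1 with h4 | h4
    · exact h4.ge
    · exact h _ h4
  rw [value, Multiset.card_cons, stageValue, if_neg (by simp), dif_pos hex, hj,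
    Multiset.erase_cons_head]
  rfl

theorem value_sub_mono_mem (i : J) (m : Multiset J) :
    value k b i m - mono (i ::ₘ m) ∈ polyLE J A m.card := by
  induction hn : m.card using Nat.strong_induction_on generalizing i m with
  | _ n ih =>
    subst hn
    by_cases h : ∀ l ∈ m, i ≤ l
    · rw [value_of_le b h, sub_self]; exact zero_mem _
    · push Not at h
      obtain ⟨j₀, hj₀, hj₀i⟩ := h
      have hne : m.toFinset.Nonempty := ⟨j₀, by simpa using hj₀⟩
      set j := m.toFinset.min' hne with hj
      have hjm : j ∈ m := by simpa using m.toFinset.min'_mem hne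
      have hjl : ∀ l ∈ m, j ≤ l := fun l hl => m.toFinset.min'_le l (by simpa using hl)
      clear_value j
      obtain ⟨t, rfl⟩ := Multiset.exists_cons_of_mem hjm
      rw [value_cons_aux b ((hjl _ hj₀).trans_lt hj₀i)
          fun l hl => hjl l (Multiset.mem_cons_of_mem hl),
        add_assoc, add_sub_cancel_left, Multiset.card_cons]
      have hlin : ∀ l : J, value k b l t ∈ polyLE J A (t.card + 1) := fun l => by
        have h := ih t.card (by simp) l t rfl
        rw [← sub_add_cancel (value k b l t) (mono (l ::ₘ t))]
        exact add_mem (polyLE_mono (Nat.le_succ _) h) (mono_mem_polyLE (by simp))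
      refine add_mem ?_ ?_
      · have hw := ih t.card (by simp) i t rfl
        have h := leibnizExtend_sub_mulVar_mem (k := k) (i := j)
          (v := stageValue k b t.card j) (n := t.card)
          (fun m hm => by
            rw [stageValue_eq_value b j hm]
            exact ih m.card (by simpa using Nat.lt_succ_of_le hm) j m rfl) le_rfl hw (b j)
        rw [← sub_add_cancel (leibnizExtend k _ _ _) (mulVar j (value k b i t - mono (i ::ₘ t)))]
        exact add_mem (polyLE_mono (Nat.le_succ _) h) (mulVar_mem hw)
      · rw [Finsupp.linearCombination_apply]
        exact Submodule.sum_mem _ fun l _ => Submodule.smul_mem _ _ (hlin l)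

variable (k) in
/-- The action of `L` on polynomials. -/
def act : L →ₗ[A] Module.End k (Poly J A) :=
  b.constr A fun i => leibnizExtend k (b i) (value k b i)

theorem act_basis (i : J) : act k b (b i) = leibnizExtend k (b i) (value k b i) := by
  simp [act]

theorem act_basis_mono (i : J) (m : Multiset J) : act k b (b i) (mono m) = value k b i m := by
  rw [act_basis, leibnizExtend_mono]

/-- The rule holds for basis vectors by construction and extends to all of L because the anchor is
A-linear. -/
theorem act_smul (X : L) (a : A) (f : Poly J A) :
    act k b X (a • f) = a • act k b X f + ⁅X, a⁆ • f := by
  induction X using basis_induction b with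
  | hb i => rw [act_basis, leibnizExtend_smul]
  | hzero => simp
  | hadd X Y hX hY =>
    simp only [map_add, LinearMap.add_apply, hX, hY, smul_add, add_lie, add_smul]; abel
  | hsmul c X hX =>
    simp only [map_smul, LinearMap.smul_apply, hX, smul_add, LieRinehartRing.lie_smul_eq_mul,
      mul_smul]
    rw [smul_comm c a]

/-- The recursion was designed for this case: `value_cons_aux` is the bracket relation solved for
its left side. -/
theorem act_act_of_le {i j : J} {m : Multiset J} (hji : j < i) (h : ∀ l ∈ m, j ≤ l) :
    act k b (b i) (act k b (b j) (mono m)) = act k b (b j) (act k b (b i) (mono m))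
      + act k b ⁅b i, b j⁆ (mono m) := by
  rw [act_basis_mono b j, value_of_le b h, act_basis_mono b i, act_basis_mono b i,
    value_cons_aux b hji h,
    leibnizExtend_congr (b j) (fun m hm => stageValue_eq_value b j hm) (value_sub_mono_mem b i m),
    ← act_basis, map_sub, act_basis_mono b j (i ::ₘ m),
    value_of_le b (m := i ::ₘ m) (by simpa using ⟨hji.le, h⟩), Multiset.cons_swap, add_sub_cancel]
  congr 1
  rw [act, Module.Basis.constr_apply, Finsupp.linearCombination_apply, Finsupp.sum, Finsupp.sum,
    LinearMap.sum_apply]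
  exact Finset.sum_congr rfl fun l _ => by rw [LinearMap.smul_apply, leibnizExtend_mono]

/-! ### Vanishing of the curvature. -/

variable (k) in
/-- The failure of `act` to respect the bracket of `X` and `Y`. -/
def defect (X Y : L) : Module.End k (Poly J A) :=
  act k b X * act k b Y - act k b Y * act k b X - act k b ⁅X, Y⁆

theorem defect_apply (X Y : L) (f : Poly J A) : defect k b X Y f =
    act k b X (act k b Y f) - act k b Y (act k b X f) - act k b ⁅X, Y⁆ f := rfl

theorem defect_swap (X Y : L) : defect k b Y X = - defect k b X Y := by
  rw [defect, defect, ← lie_skew X Y, map_neg]; abel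

theorem defect_self (X : L) : defect k b X X = 0 := by simp [defect]

/-- The first-order terms cancel, and the remaining one vanishes because the anchor respects
brackets. With `defect_smul_left`, the defect is tensorial like a curvature, so it can be checked on
basis vectors and monomials. -/
theorem defect_smul_apply (X Y : L) (a : A) (f : Poly J A) :
    defect k b X Y (a • f) = a • defect k b X Y f := by
  simp only [defect_apply, act_smul, map_add, smul_sub, lie_lie, sub_smul]
  abel

theorem defect_add_left (X X' Y : L) : defect k b (X + X') Y = defect k b X Y + defect k b X' Y := by
  simp only [defect, map_add, add_lie, add_mul, mul_add]; abel

theorem defect_smul_left (a : A) (X Y : L) : defect k b (a • X) Y = a • defect k b X Y := by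
  ext1 f
  have h : ⁅a • X, Y⁆ = a • ⁅X, Y⁆ - ⁅Y, a⁆ • X := by
    rw [← lie_skew, LieRinehartRing.leibniz_smul_right, ← lie_skew X Y, smul_neg]; abel
  simp only [LinearMap.smul_apply, defect_apply, h, map_smul, act_smul, map_sub,
    LinearMap.sub_apply, smul_sub]
  abel

/-- The Jacobi identity for commutators of operators combined with the one in L: a Bianchi identity.
-/
theorem defect_jacobi (X Y Z : L) :
    defect k b X Y * act k b Z + defect k b Y Z * act k b X + defect k b Z X * act k b Y
      = act k b Z * defect k b X Y + act k b X * defect k b Y Z + act k b Y * defect k b Z X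
        - (defect k b ⁅X, Y⁆ Z + defect k b ⁅Y, Z⁆ X + defect k b ⁅Z, X⁆ Y) := by
  have h : act k b ⁅⁅X, Y⁆, Z⁆ + act k b ⁅⁅Y, Z⁆, X⁆ + act k b ⁅⁅Z, X⁆, Y⁆ = 0 := by
    rw [← map_add, ← map_add, ← lie_skew ⁅X, Y⁆ Z, ← lie_skew ⁅Y, Z⁆ X, ← lie_skew ⁅Z, X⁆ Y,
      ← neg_eq_zero, ← map_neg, ← map_zero (act k b), ← lie_jacobi X Y Z]
    congr 1
    abel
  rw [← sub_eq_zero]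
  rw [← neg_eq_zero] at h
  rw [← h]
  simp only [defect]
  noncomm_ring

theorem defect_eq_zero_of_basis {f : Poly J A} (h : ∀ i j, defect k b (b i) (b j) f = 0) (X Y : L) :
    defect k b X Y f = 0 := by
  have key : ∀ i Y, defect k b Y (b i) f = 0 := fun i Y => by
    induction Y using basis_induction b with
    | hb j => exact h j i
    | hzero => simp [defect]
    | hadd X Y hX hY => simp [defect_add_left, hX, hY]
    | hsmul c X hX => simp [defect_smul_left, hX]
  rw [← neg_neg (defect k b X Y), ← defect_swap, LinearMap.neg_apply, neg_eq_zero]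
  induction Y using basis_induction b with
  | hb j => rw [defect_swap, LinearMap.neg_apply, key, neg_zero]
  | hzero => simp [defect]
  | hadd X Y hX hY => simp [defect_add_left, hX, hY]
  | hsmul c X hX => simp [defect_smul_left, hX]

/-- Induction on the degree, with i > j. If j is at most every letter, `act_act_of_le` applies.
Otherwise write the monomial as x_l t with l its least letter, so l < j < i and x_l t = X_l t. Apply
the Bianchi identity for i, j, l to t: every term except D(i, j) X_l t vanishes. -/
theorem defect_mono (m : Multiset J) (i j : J) : defect k b (b i) (b j) (mono m) = 0 := by
  induction hn : m.card using Nat.strong_induction_on generalizing i j m with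
  | _ n ih =>
    subst hn
    wlog hji : j < i generalizing i j
    · rcases (not_lt.1 hji).eq_or_lt with rfl | hij
      · rw [defect_self]; rfl
      · rw [defect_swap, LinearMap.neg_apply, this j i hij, neg_zero]
    have base : ∀ {i j : J} {m : Multiset J}, j < i → (∀ l ∈ m, j ≤ l) →
        defect k b (b i) (b j) (mono m) = 0 := fun hji h => by
      rw [defect_apply, act_act_of_le b hji h]; abel
    by_cases h : ∀ l ∈ m, j ≤ l
    · exact base hji h
    push Not at h
    obtain ⟨l₀, hl₀, hl₀j⟩ := h
    have hne : m.toFinset.Nonempty := ⟨l₀, by simpa using hl₀⟩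
    set l := m.toFinset.min' hne with hl
    have hlm : l ∈ m := by simpa using m.toFinset.min'_mem hne
    have hll : ∀ l' ∈ m, l ≤ l' := fun l' h => m.toFinset.min'_le l' (by simpa using h)
    have hlj : l < j := (hll _ hl₀).trans_lt hl₀j
    clear_value l
    obtain ⟨t, rfl⟩ := Multiset.exists_cons_of_mem hlm
    have hlt : ∀ l' ∈ t, l ≤ l' := fun l' h => hll l' (Multiset.mem_cons_of_mem h)
    have low : ∀ X Y, ∀ f ∈ polyLE J A t.card, defect k b X Y f = 0 := fun X Y f hf => by
      induction hf using polyLE_induction with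
      | hmono m hm =>
        exact defect_eq_zero_of_basis b
          (fun i j => ih m.card (by simpa using Nat.lt_succ_of_le hm) m i j rfl) X Y
      | hzero => simp
      | hadd f f' _ _ hf hf' => simp [hf, hf']
      | hsmul a f _ hf => simp [defect_smul_apply, hf]
    have low' := fun X Y => low X Y _ (mono_mem_polyLE (m := t) le_rfl)
    have hcons : ∀ i' j', l < i' → l < j' →
        defect k b (b i') (b l) (act k b (b j') (mono t)) = 0 := fun i' j' hi' hj' => by
      -- X_{j'} t is x_{j'} t plus terms of lower degree: the latter fall under the induction
      -- hypothesis, and in the former l is still least.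
      rw [← sub_add_cancel (act k b (b j') (mono t)) (mono (j' ::ₘ t)), map_add, act_basis_mono,
        low _ _ _ (value_sub_mono_mem b j' t), zero_add]
      exact base hi' (by simpa using ⟨hj'.le, hlt⟩)
    have hJ := LinearMap.congr_fun (defect_jacobi (k := k) b (b i) (b j) (b l)) (mono t)
    simp only [LinearMap.add_apply, LinearMap.sub_apply, Module.End.mul_apply, low', map_zero,
      add_zero, sub_zero, hcons j i hlj (hlj.trans hji), defect_swap b (b i) (b l),
      LinearMap.neg_apply,
      hcons i j (hlj.trans hji) hlj, neg_zero] at hJ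
    rwa [act_basis_mono, value_of_le b hlt] at hJ

theorem defect_eq_zero (X Y : L) : defect k b X Y = 0 := by
  refine LinearMap.ext fun f => ?_
  obtain ⟨n, hn⟩ := exists_mem_polyLE f
  induction hn using polyLE_induction with
  | hmono m _ => exact defect_eq_zero_of_basis b (defect_mono b m) X Y
  | hzero => simp
  | hadd f f' _ _ hf hf' => rw [map_add, hf, hf', map_add]
  | hsmul a f _ hf => rw [defect_smul_apply, hf]; simp

theorem act_lie (X Y : L) :
    act k b ⁅X, Y⁆ = act k b X * act k b Y - act k b Y * act k b X :=
  (sub_eq_zero.1 (defect_eq_zero b X Y)).symm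

theorem act_sub_mulLinear_mem (X : L) {n : ℕ} {f : Poly J A} (hf : f ∈ polyLE J A n) :
    act k b X f - mulLinear b X f ∈ polyLE J A n := by
  induction X using basis_induction b with
  | hb i =>
    rw [act_basis, mulLinear, Module.Basis.constr_basis]
    exact leibnizExtend_sub_mulVar_mem (fun m _ => value_sub_mono_mem b i m) le_rfl hf _
  | hzero => simp
  | hadd X Y hX hY =>
    rw [map_add, map_add, LinearMap.add_apply, LinearMap.add_apply, add_sub_add_comm]
    exact add_mem hX hY
  | hsmul a X hX =>
    rw [map_smul, map_smul, LinearMap.smul_apply, LinearMap.smul_apply, ← smul_sub]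
    exact Submodule.smul_mem _ _ hX

end Action

end

end LRFreeAction

/-! ### Embedding a projective Lie-Rinehart algebra into a free one -/

/-- The semidirect product of `g` and the free module on `J`, on which `g` acts coefficientwise
through the anchor. -/
@[ext]
structure LRFreeExtension (A g J : Type*) [Zero A] where
  /-- the component in `g` -/
  fst : g
  /-- the component in the free module -/
  snd : J →₀ A

namespace LRFreeExtension

noncomputable section

section Module

variable {R A g J : Type*} [CommRing R] [CommRing A] [Module R A] [AddCommGroup g] [Module R g]

variable (A g J) in
/-- The underlying product. -/
def equivProd : LRFreeExtension A g J ≃ g × (J →₀ A) where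
  toFun x := (x.fst, x.snd)
  invFun x := ⟨x.1, x.2⟩
  left_inv _ := rfl
  right_inv _ := rfl

instance : AddCommGroup (LRFreeExtension A g J) := (equivProd A g J).addCommGroup

instance : Module R (LRFreeExtension A g J) := (equivProd A g J).module R

variable (R A g J) in
/-- The underlying product, as a linear equivalence. -/
def linearEquivProd : LRFreeExtension A g J ≃ₗ[R] g × (J →₀ A) where
  __ := equivProd A g J
  map_add' _ _ := rfl
  map_smul' _ _ := rfl

@[simp] theorem fst_zero : (0 : LRFreeExtension A g J).fst = 0 := rfl
@[simp] theorem snd_zero : (0 : LRFreeExtension A g J).snd = 0 := rfl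
@[simp] theorem fst_add (x y : LRFreeExtension A g J) : (x + y).fst = x.fst + y.fst := rfl
@[simp] theorem snd_add (x y : LRFreeExtension A g J) : (x + y).snd = x.snd + y.snd := rfl
@[simp] theorem fst_smul (a : R) (x : LRFreeExtension A g J) : (a • x).fst = a • x.fst := rfl
@[simp] theorem snd_smul (a : R) (x : LRFreeExtension A g J) : (a • x).snd = a • x.snd := rfl

end Module

/-! ### The semidirect product as a Lie–Rinehart algebra. -/

section LieRing

variable {A g J : Type*} [CommRing A] [LieRing g] [LieRingModule g A]

instance : Bracket (LRFreeExtension A g J) (LRFreeExtension A g J) where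
  bracket x y := ⟨⁅x.fst, y.fst⁆,
    Finsupp.mapRange.addMonoidHom (LieRingModule.toEnd g A x.fst) y.snd
      - Finsupp.mapRange.addMonoidHom (LieRingModule.toEnd g A y.fst) x.snd⟩

@[simp]
theorem fst_lie (x y : LRFreeExtension A g J) : ⁅x, y⁆.fst = ⁅x.fst, y.fst⁆ := rfl

@[simp]
theorem snd_lie (x y : LRFreeExtension A g J) (j : J) :
    ⁅x, y⁆.snd j = ⁅x.fst, y.snd j⁆ - ⁅y.fst, x.snd j⁆ := rfl

instance : LieRing (LRFreeExtension A g J) where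
  add_lie x y z := by
    ext1
    · simp
    · ext j; simp; abel
  lie_add x y z := by
    ext1
    · simp
    · ext j; simp; abel
  lie_self x := by
    ext1
    · simp
    · ext j; simp
  leibniz_lie x y z := by
    ext1
    · simp
    · ext j
      -- Jacobi in the abelian summand amounts to flatness of the coefficientwise action.
      simp only [snd_lie, fst_lie, snd_add, Finsupp.add_apply, lie_sub, lie_lie]
      abel

instance : LieRingModule (LRFreeExtension A g J) A where
  bracket x a := ⁅x.fst, a⁆
  add_lie x y a := by simp
  lie_add x a b := by simp
  leibniz_lie x y a := by simp

theorem lie_base (x : LRFreeExtension A g J) (a : A) : ⁅x, a⁆ = ⁅x.fst, a⁆ := rfl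

variable [Module A g] [LieRinehartRing A g]

instance : LieRinehartRing A (LRFreeExtension A g J) where
  lie_smul_eq_mul' a b x := by simp [lie_base]
  leibniz_mul_right' x a b := by simp [lie_base]
  leibniz_smul_right' x y a := by
    ext1
    · simp [lie_base]
    · ext j
      simp [lie_base, mul_sub]
      ring

variable {k : Type*} [CommRing k] [Algebra k A] [LieAlgebra k g] [LieRinehartAlgebra k A g]

instance : LieAlgebra k (LRFreeExtension A g J) where
  lie_smul r x y := by
    ext1
    · simp
    · ext j; simp [smul_sub]

instance : LieRinehartAlgebra k A (LRFreeExtension A g J) where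
  smul_assoc r a x := by
    ext1
    · simp
    · ext j; simp
  smul_lie r x a := by simp [lie_base]
  lie_smul r x a := by simp [lie_base]

end LieRing

section Swindle

variable {A g F : Type*} [CommRing A] [AddCommGroup g] [Module A g] [AddCommGroup F] [Module A F]

/-- The Eilenberg swindle: a direct summand `g` of `F` is absorbed by a countable sum of copies
of `F`. -/
def swindle (s : g →ₗ[A] F) (π : F →ₗ[A] g) (h : ∀ X, π (s X) = X) :
    (g × (ℕ →₀ F)) ≃ₗ[A] (ℕ →₀ F) :=
  LinearEquiv.ofLinearMap
    -- Each copy of F splits as s(g) plus the kernel of π. The extra g enters the s(g) part of copy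
    -- 0, every s(g) part moves up one copy, and the kernels stay; the inverse moves them back.
    (LinearMap.coprod (Finsupp.lsingle 0 ∘ₗ s)
      (Finsupp.lmapDomain F A Nat.succ ∘ₗ Finsupp.mapRange.linearMap (s ∘ₗ π)
        + Finsupp.mapRange.linearMap (LinearMap.id - s ∘ₗ π)))
    (LinearMap.prod (π ∘ₗ Finsupp.lapply 0)
      (Finsupp.lcomapDomain Nat.succ Nat.succ_injective ∘ₗ Finsupp.mapRange.linearMap (s ∘ₗ π)
        + Finsupp.mapRange.linearMap (LinearMap.id - s ∘ₗ π)))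
    (by
      refine LinearMap.ext fun f => Finsupp.ext fun n => ?_
      cases n with
      | zero => simp [h, Finsupp.mapDomain_of_notMem_range]
      | succ n => simp [h, Finsupp.mapDomain_apply Nat.succ_injective])
    (by
      refine LinearMap.ext fun f => Prod.ext ?_ (Finsupp.ext fun n => ?_)
      · simp [h, Finsupp.mapDomain_of_notMem_range]
      · cases n with
        | zero =>
          simp [h, Finsupp.mapDomain_apply Nat.succ_injective, Finsupp.mapDomain_of_notMem_range]
        | succ n => simp [h, Finsupp.mapDomain_apply Nat.succ_injective])

/-- A basis of the extension of `g` by the free module on `ℕ × I`. -/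
def basis {I : Type*} (b : ProjectiveBasis I A g) :
    Module.Basis (ℕ × I) A (LRFreeExtension A g (ℕ × I)) :=
  .ofRepr <| linearEquivProd A A g (ℕ × I) ≪≫ₗ
    (LinearEquiv.refl A g).prodCongr (Finsupp.curryLinearEquiv A) ≪≫ₗ
    swindle
      { toFun := fun X => Finsupp.ofSupportFinite (fun i => b.form i X) (b.finite_support X)
        map_add' := fun X Y => Finsupp.ext fun i => map_add (b.form i) X Y
        map_smul' := fun a X => Finsupp.ext fun i => map_smul (b.form i) a X }
      (Finsupp.linearCombination A b.gen)
      (fun X => by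
        conv_rhs => rw [← b.sum_form_smul_gen X]
        rw [Finsupp.linearCombination_apply, Finsupp.sum]
        refine (finsum_eq_sum_of_support_subset _ fun i hi => ?_).symm
        simp only [Finset.mem_coe, Finsupp.mem_support_iff]
        exact fun h0 => hi (by
          change b.form i X = 0 at h0
          change b.form i X • b.gen i = 0
          rw [h0, zero_smul])) ≪≫ₗ
    (Finsupp.curryLinearEquiv A).symm

end Swindle

end

end LRFreeExtension

/-! ### The filtration by the length of words -/

section WordSpan

variable {A X R : Type*} [CommRing A] [Ring R] [Module A R]

variable (A) in
/-- The span of the products of fewer than `n` values of `f`. -/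
def wordSpan (f : X → R) (n : ℕ) : Submodule A R :=
  Submodule.span A {r | ∃ l : List X, l.length < n ∧ (l.map f).prod = r}

theorem word_mem_wordSpan (f : X → R) {l : List X} {n : ℕ} (h : l.length < n) :
    (l.map f).prod ∈ wordSpan A f n :=
  Submodule.subset_span ⟨l, h, rfl⟩

theorem wordSpan_mono (f : X → R) {m n : ℕ} (h : m ≤ n) : wordSpan A f m ≤ wordSpan A f n :=
  Submodule.span_mono fun _ ⟨l, hl, hr⟩ => ⟨l, hl.trans_le h, hr⟩

/-- The strict bound on length makes the filtration start at 0, which is where the inductions for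
surjectivity and injectivity end. -/
theorem wordSpan_zero (f : X → R) : wordSpan A f 0 = ⊥ := by
  simp [wordSpan]

theorem wordSpan_induction (f : X → R) {n : ℕ} {p : (r : R) → r ∈ wordSpan A f n → Prop}
    (word : ∀ (l : List X) (hl : l.length < n), p (l.map f).prod (word_mem_wordSpan f hl))
    (zero : p 0 (zero_mem _))
    (add : ∀ r r' hr hr', p r hr → p r' hr' → p (r + r') (add_mem hr hr'))
    (smul : ∀ (a : A) r hr, p r hr → p (a • r) (Submodule.smul_mem _ a hr))
    {r : R} (hr : r ∈ wordSpan A f n) : p r hr := by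
  induction hr using Submodule.span_induction with
  | mem x hx => obtain ⟨l, hl, rfl⟩ := hx; exact word l hl
  | zero => exact zero
  | add x y _ _ hx hy => exact add _ _ _ _ hx hy
  | smul a x _ hx => exact smul _ _ _ hx

theorem mul_mem_wordSpan [SMulCommClass A R R] (f : X → R) (x : X) {n : ℕ} {r : R}
    (hr : r ∈ wordSpan A f n) : f x * r ∈ wordSpan A f (n + 1) := by
  induction hr using wordSpan_induction with
  | word l hl => exact word_mem_wordSpan f (l := x :: l) (by simpa using hl)
  | zero => simp
  | add r r' _ _ hr hr' => rw [mul_add]; exact add_mem hr hr'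
  | smul a r _ hr => rw [mul_smul_comm]; exact Submodule.smul_mem _ _ hr

end WordSpan

theorem SymmetricAlgebra.exists_mem_wordSpan {A g : Type*} [CommRing A] [AddCommGroup g]
    [Module A g] (x : SymmetricAlgebra A g) : ∃ n, x ∈ wordSpan A (ι A g) n := by
  -- Multiplying an arbitrary y makes the statement stable under products.
  suffices h : ∀ x : SymmetricAlgebra A g, ∀ n, ∀ y ∈ wordSpan A (ι A g) n,
      ∃ n', x * y ∈ wordSpan A (ι A g) n' by
    obtain ⟨n, hn⟩ := h x 1 1 (word_mem_wordSpan _ (l := []) (by simp))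
    exact ⟨n, by rwa [mul_one] at hn⟩
  intro x
  induction x using SymmetricAlgebra.induction with
  | algebraMap a =>
    intro n y hy
    exact ⟨n, by rw [← Algebra.smul_def]; exact Submodule.smul_mem _ _ hy⟩
  | ι X => exact fun n y hy => ⟨n + 1, mul_mem_wordSpan _ X hy⟩
  | mul x x' hx hx' =>
    intro n y hy
    obtain ⟨m, hm⟩ := hx' n y hy
    rw [mul_assoc]
    exact hx m _ hm
  | add x x' hx hx' =>
    intro n y hy
    obtain ⟨m, hm⟩ := hx n y hy
    obtain ⟨m', hm'⟩ := hx' n y hy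
    rw [add_mul]
    exact ⟨max m m', add_mem (wordSpan_mono _ (le_max_left m m') hm)
      (wordSpan_mono _ (le_max_right m m') hm')⟩

/-! ### The word filtration of the enveloping algebra. -/

namespace LRUniversalEnveloping

variable {k A g : Type*} [CommRing k] [CommRing A] [Algebra k A] [LieRing g]
    [LieAlgebra k g] [Module A g] [LieRingModule g A]

theorem ofLie_mul_smul (X : g) (a : A) (u : LRUniversalEnveloping k A g) :
    ofLie k A g X * a • u = a • (ofLie k A g X * u) + ⁅X, a⁆ • u :=
  lieMul_smul X a u

theorem smul_mul_assoc' (a : A) (u v : LRUniversalEnveloping k A g) :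
    (a • u) * v = a • (u * v) := by
  rw [base_smul_def, base_smul_def, mul_assoc]

/-- Scalars do not commute with X, but moving one across costs only an anchor term in the original
filtration step. -/
theorem ofLie_mul_mem_wordSpan (X : g) {n : ℕ} {u : LRUniversalEnveloping k A g}
    (hu : u ∈ wordSpan A (ofLie k A g) n) :
    ofLie k A g X * u ∈ wordSpan A (ofLie k A g) (n + 1) := by
  induction hu using wordSpan_induction with
  | word l hl => exact word_mem_wordSpan _ (l := X :: l) (by simpa using hl)
  | zero => simp
  | add r r' _ _ hr hr' => rw [mul_add]; exact add_mem hr hr'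
  | smul a r hr ih =>
    rw [ofLie_mul_smul]
    exact add_mem (Submodule.smul_mem _ _ ih)
      (Submodule.smul_mem _ _ (wordSpan_mono _ (Nat.le_succ n) hr))

theorem exists_mem_wordSpan (u : LRUniversalEnveloping k A g) :
    ∃ n, u ∈ wordSpan A (ofLie k A g) n := by
  induction u using induction with
  | one => exact ⟨1, word_mem_wordSpan _ (l := []) (by simp)⟩
  | add u v hu hv =>
    obtain ⟨m, hm⟩ := hu
    obtain ⟨m', hm'⟩ := hv
    exact ⟨max m m', add_mem (wordSpan_mono _ (le_max_left m m') hm)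
      (wordSpan_mono _ (le_max_right m m') hm')⟩
  | smul a u hu =>
    obtain ⟨m, hm⟩ := hu
    exact ⟨m, Submodule.smul_mem _ _ hm⟩
  | lie X u hu =>
    obtain ⟨m, hm⟩ := hu
    exact ⟨m + 1, ofLie_mul_mem_wordSpan X hm⟩

/-- Exchanging two neighbours costs a bracket, which is again a single letter, so the difference is
a shorter word. -/
theorem word_sub_word_mem {l l' : List g} (h : l.Perm l') :
    (l.map (ofLie k A g)).prod - (l'.map (ofLie k A g)).prod
      ∈ wordSpan A (ofLie k A g) l.length := by
  induction h with
  | nil => simp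
  | cons X _ ih =>
    simp only [List.map_cons, List.prod_cons, ← mul_sub, List.length_cons]
    exact ofLie_mul_mem_wordSpan X ih
  | swap X Y l =>
    simp only [List.map_cons, List.prod_cons, List.length_cons, ← mul_assoc, ← sub_mul,
      ← ofLie_lie]
    exact word_mem_wordSpan _ (l := ⁅Y, X⁆ :: l) (by simp)
  | trans h₁ _ ih₁ ih₂ =>
    rw [← sub_add_sub_cancel]
    exact add_mem ih₁ (h₁.length_eq ▸ ih₂)

end LRUniversalEnveloping

/-! ### A retraction of the symmetrisation up to lower order -/

namespace ProjectiveBasis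

noncomputable section

open LRUniversalEnveloping LRFreeAction

section Eval

variable {I A g : Type*} [CommRing A] [AddCommGroup g] [Module A g] (b : ProjectiveBasis I A g)

/-- The evaluation of polynomials on the free extension of `g` in the symmetric algebra of `g`. -/
def evalPoly : Poly (ℕ × I) A →ₗ[A] SymmetricAlgebra A g :=
  (monomials (ℕ × I) A).constr A fun m =>
    (m.map fun j => SymmetricAlgebra.ι A g (LRFreeExtension.basis b j).fst).prod

theorem evalPoly_mono (m : Multiset (ℕ × I)) : b.evalPoly (mono m)
    = (m.map fun j => SymmetricAlgebra.ι A g (LRFreeExtension.basis b j).fst).prod := by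
  rw [evalPoly, mono, Module.Basis.constr_basis]

theorem evalPoly_mulVar (i : ℕ × I) (f : Poly (ℕ × I) A) : b.evalPoly (mulVar i f)
    = SymmetricAlgebra.ι A g (LRFreeExtension.basis b i).fst * b.evalPoly f := by
  obtain ⟨n, hn⟩ := exists_mem_polyLE f
  induction hn using polyLE_induction with
  | hmono m _ =>
    rw [mulVar_mono, evalPoly_mono, evalPoly_mono, Multiset.map_cons, Multiset.prod_cons]
  | hzero => simp
  | hadd f f' _ _ hf hf' => rw [map_add, map_add, hf, hf', map_add, mul_add]
  | hsmul a f _ hf => rw [map_smul, map_smul, hf, map_smul, mul_smul_comm]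

/-- Evaluation is induced by the A-linear projection of the extension onto g, so it respects the
leading part of the action. -/
theorem evalPoly_mulLinear (x : LRFreeExtension A g (ℕ × I)) (f : Poly (ℕ × I) A) :
    b.evalPoly (mulLinear (LRFreeExtension.basis b) x f)
      = SymmetricAlgebra.ι A g x.fst * b.evalPoly f := by
  induction x using basis_induction (LRFreeExtension.basis b) with
  | hb i => rw [mulLinear, Module.Basis.constr_basis, evalPoly_mulVar]
  | hzero => simp
  | hadd x y hx hy => simp [hx, hy, add_mul]
  | hsmul a x hx => simp [hx]

theorem evalPoly_mem {n : ℕ} {f : Poly (ℕ × I) A} (hf : f ∈ polyLE (ℕ × I) A n) :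
    b.evalPoly f ∈ wordSpan A (SymmetricAlgebra.ι A g) (n + 1) := by
  induction hf using polyLE_induction with
  | hmono m hm =>
    rw [evalPoly_mono]
    induction m using Quotient.inductionOn with
    | h l =>
    rw [Multiset.quot_mk_to_coe, Multiset.map_coe, Multiset.prod_coe]
    have h := word_mem_wordSpan (A := A) (SymmetricAlgebra.ι A g) (n := n + 1)
      (l := l.map fun j => (LRFreeExtension.basis b j).fst) (by simpa [Nat.lt_succ_iff] using hm)
    rwa [List.map_map] at h
  | hzero => simp
  | hadd f f' _ _ hf hf' => rw [map_add]; exact add_mem hf hf'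
  | hsmul a f _ hf => rw [map_smul]; exact Submodule.smul_mem _ _ hf

end Eval

variable {I k A g : Type*} [CommRing k] [CommRing A] [Algebra k A] [LieRing g]
    [LieAlgebra k g] [Module A g] [LieRingModule g A] [LieRinehartRing A g]
    [LieRinehartAlgebra k A g] [LinearOrder (ℕ × I)] (b : ProjectiveBasis I A g)

variable (I k A g) in
/-- The inclusion of `g` into its free extension. -/
def toExtension : g →ₗ[k] LRFreeExtension A g (ℕ × I) where
  toFun X := ⟨X, 0⟩
  map_add' X Y := by ext1 <;> simp
  map_smul' a X := by ext1 <;> simp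

variable (k) in
/-- The action of `U_A(g)` on polynomials. -/
def polyAction : LRUniversalEnveloping k A g →ₐ[k] Module.End k (Poly (ℕ × I) A) :=
  LRUniversalEnveloping.lift (Algebra.lsmul k k _)
    ((act k (LRFreeExtension.basis b)).restrictScalars k ∘ₗ toExtension I k A g)
    (fun X Y => by
      -- The inclusion respects brackets because the components in the free module are zero.
      have h : (toExtension I k A g ⁅X, Y⁆ : LRFreeExtension A g (ℕ × I))
          = ⁅toExtension I k A g X, toExtension I k A g Y⁆ := by
        ext1
        · rfl
        · ext j; simp [toExtension]
      simp only [LinearMap.comp_apply, LinearMap.restrictScalars_apply, h, act_lie])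
    (fun a X => by
      have h : (toExtension I k A g (a • X) : LRFreeExtension A g (ℕ × I))
          = a • toExtension I k A g X := by
        ext1
        · rfl
        · ext j; simp [toExtension]
      simp only [LinearMap.comp_apply, LinearMap.restrictScalars_apply, h, map_smul]
      rfl)
    (fun X a => by
      refine LinearMap.ext fun f => ?_
      simp only [LinearMap.comp_apply, LinearMap.restrictScalars_apply, LinearMap.sub_apply,
        Module.End.mul_apply, Algebra.lsmul_coe, act_smul, add_sub_cancel_left]
      rfl)

theorem polyAction_ofBase (a : A) :
    polyAction k b (ofBase k A g a) = Algebra.lsmul k k (Poly (ℕ × I) A) a :=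
  lift_ofBase _ _ _ _ _ a

theorem polyAction_ofLie (X : g) : polyAction k b (ofLie k A g X)
    = act k (LRFreeExtension.basis b) (toExtension I k A g X) :=
  lift_ofLie _ _ _ _ _ X

variable (k) in
/-- The symbol map `U_A(g) → S_A(g)`: it is multiplicative up to lower order. -/
def symbol : LRUniversalEnveloping k A g →ₗ[A] SymmetricAlgebra A g where
  toFun u := b.evalPoly (polyAction k b u (mono 0))
  map_add' u v := by simp
  map_smul' a u := by
    rw [base_smul_def, map_mul, Module.End.mul_apply, polyAction_ofBase, Algebra.lsmul_coe,
      map_smul, RingHom.id_apply]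

theorem symbol_one : b.symbol k 1 = 1 := by
  simp [symbol, evalPoly_mono]

theorem polyAction_word_mem (l : List g) :
    polyAction k b (l.map (ofLie k A g)).prod (mono 0) ∈ polyLE (ℕ × I) A l.length := by
  induction l with
  | nil => simpa using mono_mem_polyLE (A := A) (J := ℕ × I) (m := 0) (n := 0) (by simp)
  | cons X l ih =>
    rw [List.map_cons, List.prod_cons, map_mul, Module.End.mul_apply, List.length_cons,
      polyAction_ofLie]
    rw [← sub_add_cancel (act k _ _ _)
      (mulLinear (LRFreeExtension.basis b) (toExtension I k A g X) _)]
    exact add_mem (polyLE_mono (Nat.le_succ _) (act_sub_mulLinear_mem _ _ ih))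
      (mulLinear_mem _ _ ih)

theorem symbol_mem {n : ℕ} {u : LRUniversalEnveloping k A g}
    (hu : u ∈ wordSpan A (ofLie k A g) n) :
    b.symbol k u ∈ wordSpan A (SymmetricAlgebra.ι A g) n := by
  induction hu using wordSpan_induction with
  | word l hl => exact wordSpan_mono _ hl (b.evalPoly_mem (polyAction_word_mem b l))
  | zero => simp
  | add r r' _ _ hr hr' => rw [map_add]; exact add_mem hr hr'
  | smul a r _ hr => rw [map_smul]; exact Submodule.smul_mem _ _ hr

/-- On words this is the estimate `act_sub_mulLinear_mem`, evaluated in the symmetric algebra;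
scalars contribute only anchor terms of no greater order. -/
theorem symbol_ofLie_mul (X : g) {n : ℕ} {u : LRUniversalEnveloping k A g}
    (hu : u ∈ wordSpan A (ofLie k A g) n) :
    b.symbol k (ofLie k A g X * u) - SymmetricAlgebra.ι A g X * b.symbol k u
      ∈ wordSpan A (SymmetricAlgebra.ι A g) n := by
  induction hu using wordSpan_induction with
  | word l hl =>
    have h := b.evalPoly_mem (act_sub_mulLinear_mem (k := k) (LRFreeExtension.basis b)
      (toExtension I k A g X) (polyAction_word_mem (k := k) b l))
    rw [map_sub, evalPoly_mulLinear, ← polyAction_ofLie, ← Module.End.mul_apply, ← map_mul] at h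
    exact wordSpan_mono _ hl h
  | zero => simp
  | add r r' _ _ hr hr' =>
    rw [mul_add, map_add, map_add, mul_add, add_sub_add_comm]; exact add_mem hr hr'
  | smul a r hr ih =>
    rw [ofLie_mul_smul, map_add, map_smul, map_smul, map_smul, mul_smul_comm, add_sub_right_comm,
      ← smul_sub]
    exact add_mem (Submodule.smul_mem _ _ ih) (Submodule.smul_mem _ _ (b.symbol_mem hr))

end

end ProjectiveBasis

/-! ### Bijectivity of the symmetrisation -/

namespace ProjectiveBasis

noncomputable section

open LRUniversalEnveloping LRFreeAction

section

variable {I A g : Type*} [CommRing A] [AddCommGroup g] [Module A g] (b : ProjectiveBasis I A g)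

theorem sum_supp (X : g) : ∑ i ∈ b.supp X, b.form i X • b.gen i = X := by
  conv_rhs => rw [← b.sum_form_smul_gen X]
  refine (finsum_eq_sum_of_support_subset _ fun i hi => ?_).symm
  simp only [supp, Set.Finite.coe_toFinset]
  exact fun h0 => hi (by simp only at h0; simp [h0])

theorem toPolynomial_ι (X : g) : b.toPolynomial (SymmetricAlgebra.ι A g X)
    = ∑ i ∈ b.supp X, b.form i X • MvPolynomial.X i := by
  rw [toPolynomial, SymmetricAlgebra.lift_ι_apply]
  refine finsum_eq_sum_of_support_subset _ fun i hi => ?_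
  simp only [supp, Set.Finite.coe_toFinset]
  exact fun h0 => hi (by simp only at h0; simp [h0])

theorem toPolynomial_mem {n : ℕ} {f : SymmetricAlgebra A g}
    (hf : f ∈ wordSpan A (SymmetricAlgebra.ι A g) n) :
    b.toPolynomial f ∈ wordSpan A (MvPolynomial.X (R := A) (σ := I)) n := by
  induction hf using wordSpan_induction with
  | word l hl =>
    induction l generalizing n with
    | nil =>
      rw [List.map_nil, List.prod_nil, map_one]
      exact word_mem_wordSpan (A := A) (MvPolynomial.X (R := A) (σ := I)) (l := [])
        (by simpa using hl)
    | cons X l ih =>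
      obtain ⟨n, rfl⟩ := Nat.exists_eq_succ_of_ne_zero (Nat.ne_zero_of_lt hl)
      rw [List.map_cons, List.prod_cons, map_mul, toPolynomial_ι, Finset.sum_mul]
      refine Submodule.sum_mem _ fun i _ => ?_
      rw [smul_mul_assoc]
      exact Submodule.smul_mem _ _ (mul_mem_wordSpan _ i (ih (by simpa using hl)))
  | zero => simp
  | add r r' _ _ hr hr' => rw [map_add]; exact add_mem hr hr'
  | smul a r _ hr => rw [map_smul]; exact Submodule.smul_mem _ _ hr

end

/-! ### Symmetrisation up to lower order, and surjectivity. -/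

section

variable {I A g : Type*} [CommRing A] [LieRing g] [Module A g] (b : ProjectiveBasis I A g)
  {k : Type*} [Field k] [Algebra k A] [LieAlgebra k g] [LieRingModule g A]

theorem averageMonomials_word (l : List I) :
    b.averageMonomials k (l.map MvPolynomial.X).prod
      = averagedProduct k fun i => ofLie k A g (b.gen (l.get i)) := by
  rw [← averageMonomials_prod, ← List.prod_ofFn]
  congr 2
  conv_lhs => rw [← List.ofFn_get l, List.map_ofFn]
  rfl

theorem ofLie_eq_sum (X : g) :
    ofLie k A g X = ∑ i ∈ b.supp X, b.form i X • ofLie k A g (b.gen i) := by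
  conv_lhs => rw [← b.sum_supp X, map_sum]
  exact Finset.sum_congr rfl fun i _ => ofLie_smul _ _

theorem symmetrisation_one : b.symmetrisation k (1 : SymmetricAlgebra A g) = 1 := by
  have h := b.symmetrisation_prod k (n := 0) Fin.elim0
  simpa using h

variable [CharZero k]

theorem averageMonomials_word_sub_mem (l : List I) :
    b.averageMonomials k (l.map MvPolynomial.X).prod - (l.map fun i => ofLie k A g (b.gen i)).prod
      ∈ wordSpan A (ofLie k A g) l.length := by
  have hne : (l.length.factorial : k) ≠ 0 := by exact_mod_cast l.length.factorial_ne_zero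
  -- The word is the average of n! copies of itself, to be compared with its reorderings one by one.
  have h : (l.map fun i => ofLie k A g (b.gen i)).prod = (l.length.factorial : k)⁻¹ •
      ∑ _σ : Equiv.Perm (Fin l.length), (l.map fun i => ofLie k A g (b.gen i)).prod := by
    rw [Finset.sum_const, Finset.card_univ, Fintype.card_perm, Fintype.card_fin,
      ← Nat.cast_smul_eq_nsmul k, smul_smul, inv_mul_cancel₀ hne, one_smul]
  rw [averageMonomials_word, averagedProduct, h, ← smul_sub, ← Finset.sum_sub_distrib]
  refine Submodule.smul_of_tower_mem _ _ (Submodule.sum_mem _ fun σ _ => ?_)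
  have hp := word_sub_word_mem (k := k) (A := A) (l := List.ofFn fun i => b.gen (l.get (σ i)))
    (l' := l.map b.gen) (by
      conv_rhs => rw [← List.ofFn_get l, List.map_ofFn]
      exact Equiv.Perm.ofFn_comp_perm σ (b.gen ∘ l.get))
  rw [List.map_ofFn, List.map_map, List.length_ofFn] at hp
  exact hp

theorem averageMonomials_mem {n : ℕ} {p : MvPolynomial I A}
    (hp : p ∈ wordSpan A (MvPolynomial.X (R := A) (σ := I)) n) :
    b.averageMonomials k p ∈ wordSpan A (ofLie k A g) n := by
  induction hp using wordSpan_induction with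
  | word l hl =>
    rw [← sub_add_cancel (b.averageMonomials k _) (l.map fun i => ofLie k A g (b.gen i)).prod]
    refine add_mem (wordSpan_mono _ hl.le (b.averageMonomials_word_sub_mem l)) ?_
    have h := word_mem_wordSpan (A := A) (ofLie k A g) (l := l.map b.gen) (n := n)
      (by simpa using hl)
    rwa [List.map_map] at h
  | zero => simp
  | add r r' _ _ hr hr' => rw [map_add]; exact add_mem hr hr'
  | smul a r _ hr => rw [map_smul]; exact Submodule.smul_mem _ _ hr

/-- Both terms agree up to lower order with the unaveraged word beginning with χ_i. -/
theorem averageMonomials_X_mul_word_sub_mem (i : I) (l : List I) :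
    b.averageMonomials k (MvPolynomial.X i * (l.map MvPolynomial.X).prod)
      - ofLie k A g (b.gen i) * b.averageMonomials k (l.map MvPolynomial.X).prod
      ∈ wordSpan A (ofLie k A g) (l.length + 1) := by
  have h₁ := b.averageMonomials_word_sub_mem (k := k) (i :: l)
  have h₂ := ofLie_mul_mem_wordSpan (b.gen i) (b.averageMonomials_word_sub_mem (k := k) l)
  rw [mul_sub] at h₂
  have h₃ := sub_mem h₁ h₂
  rwa [List.map_cons, List.map_cons, List.prod_cons, List.prod_cons,
    sub_sub_sub_cancel_right] at h₃

theorem averageMonomials_mul_sub_mem (X : g) {n : ℕ} {p : MvPolynomial I A}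
    (hp : p ∈ wordSpan A (MvPolynomial.X (R := A) (σ := I)) n) :
    b.averageMonomials k (b.toPolynomial (SymmetricAlgebra.ι A g X) * p)
      - ofLie k A g X * b.averageMonomials k p ∈ wordSpan A (ofLie k A g) n := by
  induction hp using wordSpan_induction with
  | word l hl =>
    rw [toPolynomial_ι, b.ofLie_eq_sum X, Finset.sum_mul, Finset.sum_mul, map_sum,
      ← Finset.sum_sub_distrib]
    refine Submodule.sum_mem _ fun i _ => ?_
    rw [smul_mul_assoc, map_smul, smul_mul_assoc', ← smul_sub]
    exact Submodule.smul_mem _ _ (wordSpan_mono _ hl (b.averageMonomials_X_mul_word_sub_mem i l))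
  | zero => simp
  | add r r' _ _ hr hr' =>
    rw [mul_add, map_add, map_add, mul_add, add_sub_add_comm]; exact add_mem hr hr'
  | smul a r hr ih =>
    rw [mul_smul_comm, map_smul, map_smul, ofLie_mul_smul, ← sub_sub, ← smul_sub]
    exact sub_mem (Submodule.smul_mem _ _ ih) (Submodule.smul_mem _ _ (b.averageMonomials_mem hr))

theorem symmetrisation_mem {n : ℕ} {f : SymmetricAlgebra A g}
    (hf : f ∈ wordSpan A (SymmetricAlgebra.ι A g) n) :
    b.symmetrisation k f ∈ wordSpan A (ofLie k A g) n :=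
  b.averageMonomials_mem (b.toPolynomial_mem hf)

theorem symmetrisation_mul_sub_mem (X : g) {n : ℕ} {f : SymmetricAlgebra A g}
    (hf : f ∈ wordSpan A (SymmetricAlgebra.ι A g) n) :
    b.symmetrisation k (SymmetricAlgebra.ι A g X * f) - ofLie k A g X * b.symmetrisation k f
      ∈ wordSpan A (ofLie k A g) n := by
  have h := b.averageMonomials_mul_sub_mem (k := k) X (b.toPolynomial_mem hf)
  rwa [← map_mul] at h

theorem wordSpan_le_map_symmetrisation (n : ℕ) : wordSpan A (ofLie k A g) n
    ≤ (wordSpan A (SymmetricAlgebra.ι A g) n).map (b.symmetrisation k) := by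
  induction n with
  | zero => rw [wordSpan_zero]; exact bot_le
  | succ n ih =>
    refine Submodule.span_le.2 ?_
    rintro _ ⟨l, hl, rfl⟩
    cases l with
    | nil => exact ⟨1, word_mem_wordSpan _ (l := []) (by simp), by simp [symmetrisation_one]⟩
    | cons X l =>
      obtain ⟨f, hf, hfl⟩ := ih (word_mem_wordSpan (ofLie k A g) (l := l) (by simpa using hl))
      obtain ⟨f', hf', hfl'⟩ := ih (b.symmetrisation_mul_sub_mem X hf)
      -- Here S(f) is the tail of the word and S(f') is the error S(X f) - X S(f), so X f - f' maps
      -- to the whole word.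
      refine ⟨SymmetricAlgebra.ι A g X * f - f', sub_mem (mul_mem_wordSpan _ X hf)
        (wordSpan_mono _ (Nat.le_succ n) hf'), ?_⟩
      rw [map_sub, hfl', sub_sub_cancel, hfl, List.map_cons, List.prod_cons]

theorem symmetrisation_surjective : Function.Surjective (b.symmetrisation k) := fun u => by
  obtain ⟨n, hn⟩ := exists_mem_wordSpan u
  obtain ⟨f, -, hf⟩ := b.wordSpan_le_map_symmetrisation n hn
  exact ⟨f, hf⟩

/-! ### Injectivity. -/

variable [LieRinehartRing A g] [LieRinehartAlgebra k A g]

theorem symbol_symmetrisation_word_sub_mem [LinearOrder (ℕ × I)] (l : List g) :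
    b.symbol k (b.symmetrisation k (l.map (SymmetricAlgebra.ι A g)).prod)
      - (l.map (SymmetricAlgebra.ι A g)).prod
      ∈ wordSpan A (SymmetricAlgebra.ι A g) l.length := by
  induction l with
  | nil => simp [symmetrisation_one, symbol_one]
  | cons X l ih =>
    have hl := word_mem_wordSpan (A := A) (SymmetricAlgebra.ι A g) (l := l) (Nat.lt_succ_self _)
    have h₁ := b.symbol_mem (b.symmetrisation_mul_sub_mem (k := k) X hl)
    have h₂ := b.symbol_ofLie_mul X (b.symmetrisation_mem (k := k) hl)
    have h₃ := mul_mem_wordSpan (SymmetricAlgebra.ι A g) X ih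
    rw [map_sub] at h₁
    rw [mul_sub] at h₃
    -- The three errors telescope: S against X, the symbol against X, and X times the error for the
    -- tail.
    have h := add_mem (add_mem h₁ h₂) h₃
    rwa [sub_add_sub_cancel, sub_add_sub_cancel] at h

theorem symbol_symmetrisation_sub_mem [LinearOrder (ℕ × I)] {n : ℕ} {f : SymmetricAlgebra A g}
    (hf : f ∈ wordSpan A (SymmetricAlgebra.ι A g) (n + 1)) :
    b.symbol k (b.symmetrisation k f) - f ∈ wordSpan A (SymmetricAlgebra.ι A g) n := by
  induction hf using wordSpan_induction with
  | word l hl =>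
    exact wordSpan_mono _ (Nat.lt_succ_iff.1 hl) (b.symbol_symmetrisation_word_sub_mem l)
  | zero => simp
  | add r r' _ _ hr hr' => rw [map_add, map_add, add_sub_add_comm]; exact add_mem hr hr'
  | smul a r _ hr => rw [map_smul, map_smul, ← smul_sub]; exact Submodule.smul_mem _ _ hr

theorem symmetrisation_injective : Function.Injective (b.symmetrisation k) := by
  classical
  -- Any linear order serves: it enters the symbol but not S.
  let _ : LinearOrder (ℕ × I) := linearOrderOfSTO WellOrderingRel
  rw [injective_iff_map_eq_zero]
  intro f hf
  obtain ⟨n, hn⟩ := SymmetricAlgebra.exists_mem_wordSpan f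
  induction n with
  | zero => simpa [wordSpan_zero] using hn
  | succ n ih =>
    have h := b.symbol_symmetrisation_sub_mem (k := k) hn
    rw [hf, map_zero, zero_sub] at h
    exact ih ((Submodule.neg_mem_iff _).1 h)

end

end

end ProjectiveBasis

/-! ### Polarisation -/

section Polarisation

open Finset

/-- Inclusion–exclusion: the sum expands the product over i of -1 + [i is not in the range of p],
which vanishes unless p is onto. -/
theorem sum_neg_one_pow_card_mul_ite {n : ℕ} {R : Type*} [CommRing R] (p : Fin n → Fin n) :
    ∑ s : Finset (Fin n), (-1 : R) ^ #s * (if ∀ i, p i ∈ s then 1 else 0)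
      = if Function.Bijective p then (-1) ^ n else 0 := by
  classical
  have h := Finset.prod_add (fun _ => (-1 : R)) (fun i => if i ∈ Set.range p then 0 else 1)
    (univ : Finset (Fin n))
  have hl : ∏ i : Fin n, ((-1 : R) + if i ∈ Set.range p then 0 else 1)
      = if Function.Bijective p then (-1) ^ n else 0 := by
    split_ifs with hp
    · simp [hp.2.range_eq]
    · rw [← Finite.surjective_iff_bijective, ← Set.range_eq_univ, Set.eq_univ_iff_forall] at hp
      push Not at hp
      obtain ⟨i, hi⟩ := hp
      exact Finset.prod_eq_zero (mem_univ i) (by rw [if_neg hi]; simp)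
  rw [← hl, h, Finset.powerset_univ]
  refine Finset.sum_congr rfl fun s _ => ?_
  rw [Finset.prod_const]
  congr 1
  split_ifs with hs
  · refine (Finset.prod_eq_one fun i hi => if_neg ?_).symm
    rintro ⟨j, rfl⟩
    simp [hs] at hi
  · push Not at hs
    obtain ⟨i, hi⟩ := hs
    have hi' : p i ∈ univ \ s := by simpa using hi
    symm
    exact Finset.prod_eq_zero hi' (if_pos ⟨i, rfl⟩)

/-- Expand each power over functions p; the alternating sum keeps only the bijective ones, and each
of these gives the same product. -/
theorem polarisation {n : ℕ} {R : Type*} [CommRing R] (x : Fin n → R) :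
    ∑ s : Finset (Fin n), (-1 : R) ^ #s * (∑ i ∈ s, x i) ^ n
      = (-1) ^ n * (#{p : Fin n → Fin n | Function.Bijective p} • ∏ i, x i) := by
  classical
  have h : ∀ s : Finset (Fin n), (∑ i ∈ s, x i) ^ n
      = ∑ p : Fin n → Fin n, (if ∀ i, p i ∈ s then 1 else 0) * ∏ i, x (p i) := fun s => by
    have h := Finset.prod_univ_sum (fun _ : Fin n => s) (fun _ i => x i)
    rw [Finset.prod_const, Finset.card_univ, Fintype.card_fin] at h
    rw [h]
    simp only [ite_mul, one_mul, zero_mul]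
    rw [← Finset.sum_filter]
    refine Finset.sum_congr ?_ fun _ _ => rfl
    ext p
    simp
  simp only [h, Finset.mul_sum]
  rw [Finset.sum_comm]
  simp only [← mul_assoc, ← Finset.sum_mul, sum_neg_one_pow_card_mul_ite]
  simp only [ite_mul, zero_mul]
  rw [← Finset.sum_filter, ← Finset.sum_const, Finset.mul_sum]
  refine Finset.sum_congr rfl fun p hp => ?_
  rw [(Finset.mem_filter.1 hp).2.prod_comp]

theorem prod_mem_of_sum_pow_mem {k R : Type*} [Field k] [CharZero k] [CommRing R] [Algebra k R]
    (Q : Submodule k R) {n : ℕ} (x : Fin n → R)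
    (h : ∀ s : Finset (Fin n), (∑ i ∈ s, x i) ^ n ∈ Q) : ∏ i, x i ∈ Q := by
  classical
  have hsign : ∀ (m : ℕ) (r : R), r ∈ Q → (-1) ^ m * r ∈ Q := fun m r hr => by
    rcases neg_one_pow_eq_or R m with h | h <;> simpa [h] using hr
  have hsum := polarisation x
  have hmem := hsign n _ (hsum ▸ Submodule.sum_mem Q fun s _ => hsign _ _ (h s))
  rw [← mul_assoc, ← mul_pow, neg_one_mul, neg_neg, one_pow, one_mul,
    ← Nat.cast_smul_eq_nsmul k] at hmem
  -- Only the nonvanishing of the number of bijections matters, and the identity is one.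
  refine (Submodule.smul_mem_iff Q ?_).1 hmem
  rw [Nat.cast_ne_zero, Finset.card_ne_zero]
  exact ⟨id, Finset.mem_filter.2 ⟨Finset.mem_univ _, Function.bijective_id⟩⟩

/-- Linear maps on polynomials are determined by the powers of sums of variables. -/
theorem MvPolynomial.linearMap_ext_of_pow (k : Type*) {I A M : Type*} [Field k] [CharZero k]
    [CommRing A] [Algebra k A] [AddCommGroup M] [Module A M] {F G : MvPolynomial I A →ₗ[A] M}
    (h : ∀ (n : ℕ) (j : Fin n → I) (s : Finset (Fin n)),
      F ((∑ i ∈ s, X (j i)) ^ n) = G ((∑ i ∈ s, X (j i)) ^ n)) : F = G := by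
  refine LinearMap.ext fun p => ?_
  have hp : p ∈ Submodule.span A (Submonoid.closure (Set.range (X (R := A) (σ := I)))
      : Set (MvPolynomial I A)) := by
    rw [← Algebra.adjoin_eq_span, MvPolynomial.adjoin_range_X]
    trivial
  induction hp using Submodule.span_induction with
  | mem x hx =>
    obtain ⟨l, hl, rfl⟩ := Submonoid.exists_list_of_mem_closure hx
    choose j hj using fun i : Fin l.length => hl (l.get i) (List.get_mem l i)
    have hprod : l.prod = ∏ i, X (R := A) (j i) := by
      simp only [hj, ← List.prod_ofFn, List.ofFn_get]
    rw [hprod]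
    exact prod_mem_of_sum_pow_mem ((LinearMap.eqLocus F G).restrictScalars k) _ (h _ j)
  | zero => simp
  | add x y _ _ hx hy => rw [map_add, map_add, hx, hy]
  | smul a x _ hx => rw [map_smul, map_smul, hx]

end Polarisation

/-! ### Compatibility of the symmetrisation with the coalgebra structures -/

/-- A is not central in U, so U ⊗ U carries no evident ring structure in which to expand (X ⊗ 1 + 1
⊗ X)^n; Pascal's rule is applied to the diagonal operator instead. -/
theorem LRUniversalEnveloping.comul_pow {k A g : Type*} [CommRing k] [CommRing A] [Algebra k A]
    [LieRing g] [LieAlgebra k g] [Module A g] [LieRingModule g A] (X : g) (n : ℕ) :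
    comul k A g (ofLie k A g X ^ n)
      = ∑ ij ∈ Finset.HasAntidiagonal.antidiagonal n,
      n.choose ij.1 • ((ofLie k A g X ^ ij.1) ⊗ₜ[A] (ofLie k A g X ^ ij.2)) := by
  induction n with
  | zero => simp [comul_one]
  | succ n ih =>
    rw [pow_succ', comul_lie_mul, ih, map_sum, Finset.sum_antidiagonal_choose_succ_nsmul
      (fun i j => (ofLie k A g X ^ i) ⊗ₜ[A] (ofLie k A g X ^ j)), ← Finset.sum_add_distrib]
    refine Finset.sum_congr rfl fun ij hij => ?_
    rw [map_nsmul, lieTensor_tmul, ← pow_succ', ← pow_succ', nsmul_add, add_comm,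
      ← Nat.choose_symm_of_eq_add (Finset.HasAntidiagonal.mem_antidiagonal.1 hij).symm]

namespace ProjectiveBasis

noncomputable section

open LRUniversalEnveloping

/-- The comultiplication of polynomials in which the variables are primitive. -/
def polynomialComul (I A : Type*) [CommRing A] :
    MvPolynomial I A →ₐ[A] MvPolynomial I A ⊗[A] MvPolynomial I A :=
  MvPolynomial.aeval fun i => MvPolynomial.X i ⊗ₜ 1 + 1 ⊗ₜ MvPolynomial.X i

theorem polynomialComul_sum_pow {I A : Type*} [CommRing A] {m : ℕ} (j : Fin m → I)
    (s : Finset (Fin m)) (n : ℕ) :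
    polynomialComul I A ((∑ i ∈ s, MvPolynomial.X (j i)) ^ n)
      = ∑ ij ∈ Finset.HasAntidiagonal.antidiagonal n,
      n.choose ij.1 • (((∑ i ∈ s, MvPolynomial.X (j i)) ^ ij.1) ⊗ₜ[A]
        ((∑ i ∈ s, MvPolynomial.X (j i)) ^ ij.2)) := by
  have h : polynomialComul I A (∑ i ∈ s, MvPolynomial.X (j i))
      = (∑ i ∈ s, MvPolynomial.X (j i)) ⊗ₜ 1 + 1 ⊗ₜ (∑ i ∈ s, MvPolynomial.X (j i)) := by
    simp [polynomialComul, Finset.sum_add_distrib, TensorProduct.sum_tmul, TensorProduct.tmul_sum]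
  rw [map_pow, h, (Commute.all _ _).add_pow']
  simp only [Algebra.TensorProduct.tmul_pow, one_pow, Algebra.TensorProduct.tmul_mul_tmul, mul_one,
    one_mul]

/-- Both sides are algebra morphisms in x, and they agree on the primitive generators. -/
theorem polynomialComul_toPolynomial {I A g : Type*} [CommRing A] [AddCommGroup g] [Module A g]
    (b : ProjectiveBasis I A g) (x : SymmetricAlgebra A g) :
    polynomialComul I A (b.toPolynomial x)
      = TensorProduct.map b.toPolynomial.toLinearMap b.toPolynomial.toLinearMap
        (Coalgebra.comul x) := by
  have h : (polynomialComul I A).comp b.toPolynomial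
      = (Algebra.TensorProduct.map b.toPolynomial b.toPolynomial).comp
        (Bialgebra.comulAlgHom A (SymmetricAlgebra A g)) := by
    refine SymmetricAlgebra.algHom_ext (LinearMap.ext fun X => ?_)
    simp [toPolynomial_ι, polynomialComul, TensorProduct.sum_tmul, TensorProduct.tmul_sum,
      Finset.sum_add_distrib, TensorProduct.smul_tmul']
  exact DFunLike.congr_fun h x

theorem aeval_zero_toPolynomial {I A g : Type*} [CommRing A] [AddCommGroup g] [Module A g]
    (b : ProjectiveBasis I A g) (x : SymmetricAlgebra A g) :
    MvPolynomial.aeval (fun _ => (0 : A)) (b.toPolynomial x) = Coalgebra.counit x := by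
  have h : (MvPolynomial.aeval fun _ => (0 : A)).comp b.toPolynomial
      = Bialgebra.counitAlgHom A (SymmetricAlgebra A g) := by
    refine SymmetricAlgebra.algHom_ext (LinearMap.ext fun X => ?_)
    simp [toPolynomial_ι, SymmetricAlgebra.algebraMapInv_ι]
  exact DFunLike.congr_fun h x

theorem sum_pow_eq_sum_prod_ofFn {J U : Type*} [Ring U] (s : Finset J) (u : J → U) (n : ℕ) :
    (∑ i ∈ s, u i) ^ n
      = ∑ p ∈ Fintype.piFinset fun _ : Fin n => s, (List.ofFn fun i => u (p i)).prod := by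
  have h := (MultilinearMap.mkPiAlgebraFin ℤ n U).map_sum_finset (fun _ i => u i) fun _ => s
  simpa only [MultilinearMap.mkPiAlgebraFin_apply, List.ofFn_const, List.prod_replicate] using h

/-! ### Powers of sums of variables, and the coring structure. -/

section

variable {I A g : Type*} [CommRing A] [LieRing g] [Module A g] (b : ProjectiveBasis I A g)
  {k : Type*} [Field k] [CharZero k] [Algebra k A] [LieAlgebra k g] [LieRingModule g A]

/-- Expanding the power gives the sum over all words of length n in `s`. Permuting positions
preserves that set of words, so every permutation contributes the same sum and averaging has no
effect. -/
theorem averageMonomials_sum_pow {m : ℕ} (j : Fin m → I) (s : Finset (Fin m)) (n : ℕ) :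
    b.averageMonomials k ((∑ i ∈ s, MvPolynomial.X (j i)) ^ n)
      = ofLie k A g (∑ i ∈ s, b.gen (j i)) ^ n := by
  have h := Finset.prod_univ_sum (fun _ : Fin n => s)
    (fun _ i => (MvPolynomial.X (j i) : MvPolynomial I A))
  rw [Finset.prod_const, Finset.card_univ, Fintype.card_fin] at h
  have hne : (n.factorial : k) ≠ 0 := by exact_mod_cast n.factorial_ne_zero
  rw [h, map_sum, map_sum, sum_pow_eq_sum_prod_ofFn]
  simp only [averageMonomials_prod b k fun i => j _, averagedProduct]
  rw [← Finset.smul_sum, Finset.sum_comm, inv_smul_eq_iff₀ hne]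
  have hσ : ∀ σ : Equiv.Perm (Fin n), ∑ p ∈ Fintype.piFinset fun _ : Fin n => s,
      (List.ofFn fun i => ofLie k A g (b.gen (j (p (σ i))))).prod
      = ∑ p ∈ Fintype.piFinset fun _ : Fin n => s,
        (List.ofFn fun i => ofLie k A g (b.gen (j (p i)))).prod := fun σ =>
    Finset.sum_nbij' (fun p => p ∘ σ) (fun p => p ∘ σ.symm)
      (fun p hp => by simp at hp ⊢; exact fun i => hp _)
      (fun p hp => by simp at hp ⊢; exact fun i => hp _)
      (fun p _ => by ext; simp) (fun p _ => by ext; simp) (fun p _ => rfl)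
  simp only [hσ]
  rw [Finset.sum_const, Finset.card_univ, Fintype.card_perm, Fintype.card_fin,
    ← Nat.cast_smul_eq_nsmul k]

theorem comul_averageMonomials (p : MvPolynomial I A) :
    comul k A g (b.averageMonomials k p)
      = TensorProduct.map (b.averageMonomials k) (b.averageMonomials k)
        (polynomialComul I A p) := by
  have h : comul k A g ∘ₗ b.averageMonomials k
      = TensorProduct.map (b.averageMonomials k) (b.averageMonomials k) ∘ₗ
        (polynomialComul I A).toLinearMap := by
    refine MvPolynomial.linearMap_ext_of_pow k fun n j s => ?_
    rw [LinearMap.comp_apply, LinearMap.comp_apply, AlgHom.toLinearMap_apply,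
      averageMonomials_sum_pow, comul_pow, polynomialComul_sum_pow]
    refine Eq.trans (Finset.sum_congr rfl fun ij _ => ?_) (map_sum _ _ _).symm
    rw [map_nsmul, TensorProduct.map_tmul, averageMonomials_sum_pow, averageMonomials_sum_pow]
  exact LinearMap.congr_fun h p

variable [LieRinehartRing A g] [LieRinehartAlgebra k A g]

theorem counit_averageMonomials (p : MvPolynomial I A) :
    counit k A g (b.averageMonomials k p) = MvPolynomial.aeval (fun _ => (0 : A)) p := by
  have h : counit k A g ∘ₗ b.averageMonomials k
      = (MvPolynomial.aeval fun _ : I => (0 : A)).toLinearMap := by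
    refine MvPolynomial.linearMap_ext_of_pow k fun n j s => ?_
    rw [LinearMap.comp_apply, averageMonomials_sum_pow, AlgHom.toLinearMap_apply]
    -- A positive power of X has counit ω(X) applied to 1 or to 0.
    have hpos : ∀ (X : g) (n : ℕ), counit k A g (ofLie k A g X ^ (n + 1)) = 0 := fun X n => by
      induction n with
      | zero => rw [pow_succ', pow_zero, counit_lie_mul, counit_one, LRFreeAction.lie_one]
      | succ n ih => rw [pow_succ', counit_lie_mul, ih, lie_zero]
    cases n with
    | zero => simp [counit_one]
    | succ n => rw [hpos]; simp
  exact LinearMap.congr_fun h p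

variable (k) in
/-- The symmetrisation map as an isomorphism of coalgebras. -/
def symmetrisationEquiv : SymmetricAlgebra A g ≃ₗc[A] LRUniversalEnveloping k A g :=
  CoalgEquiv.ofBijective
    (f := ({ b.symmetrisation k with
      counit_comp := LinearMap.ext fun x =>
        (b.counit_averageMonomials _).trans (b.aeval_zero_toPolynomial x)
      map_comp_comul := LinearMap.ext fun x => by
        refine Eq.trans ?_ (b.comul_averageMonomials _).symm
        rw [AlgHom.toLinearMap_apply, polynomialComul_toPolynomial, ← LinearMap.comp_apply,
          ← LinearMap.comp_apply, ← TensorProduct.map_comp]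
        rfl } : SymmetricAlgebra A g →ₗc[A] LRUniversalEnveloping k A g))
    ⟨b.symmetrisation_injective, b.symmetrisation_surjective⟩

end

end

end ProjectiveBasis

theorem theorem1p8 {k A g I : Type*} [Field k] [CharZero k] [CommRing A] [Algebra k A]
    [LieRing g] [LieAlgebra k g] [Module A g] [LieRingModule g A] [LieRinehartRing A g]
    [LieRinehartAlgebra k A g] [Module.Projective A g] (b : ProjectiveBasis I A g) :
    ∃ S : SymmetricAlgebra A g ≃ₗc[A] LRUniversalEnveloping k A g,
      ∀ x : SymmetricAlgebra A g, S x = b.symmetrisation k x :=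
  ⟨b.symmetrisationEquiv k, fun _ => rfl⟩
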